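/- **Setting.** Let $\Theta\subseteq\mathbb R^d$ be an open convex set (bounded, or unbounded, possibly all of $\mathbb R^d$). Let $p$ be a prior probability density on $\Theta$ that is smooth and positive on $\Theta$, let $\delta\mathcal L:\Theta\to\mathbb R$ be a fixed function (the optimality gap), and let $$V(\theta)=-\delta\mathcal L(\theta)-\log p(\theta).$$ Assume that $V$ is differentiable on $\Theta$ with $\|\nabla V(\theta_1)-\nabla V(\theta_2)\|\le L\|\theta_1-\theta_2\|$ for all $\theta_1,\theta_2\in\Theta$, and that $z=\int_\Theta e^{-V}<\infty$ (automatic if $\Theta$ is bounded). The posterior is the probability density $p'=e^{-V}/z$ on $\Theta$. Let $k(x,y)=\exp(-\|x-y\|^2/h)$, $h>0$, be the RBF kernel, $\mathcal H$ its reproducing kernel Hilbert space and $\mathcal H^d$ the $d$-fold product. For a probability measure $\mu$ put $$\phi^*_\mu=\mathbb E_{\theta\sim\mu}\big[k(\theta,\cdot)\nabla\log p'(\theta)+\nabla_\theta k(\theta,\cdot)\big]\in\mathcal H^d,\qquad \mathrm{KSD}_{p'}(\mu)=\|\phi^*_\mu\|_{\mathcal H^d}^2 .$$ For a step size $\zeta>0$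 the (population) SVGD iterates are $\mu_0=p$ and $\mu_{t+1}=(\mathrm{id}+\zeta\,\phi^*_{\mu_t})_{\#}\mu_t$. Let $R\ge 0$. **Theorem (SVGD convergence).** 1. There is $B>0$ with $\|k(\theta,\cdot)\|_{\mathcal H}\le B$ and $\|\nabla_\theta k(\theta,\cdot)\|_{\mathcal H^d}\le B$ for all $\theta\in\Theta$. 2. There is $C>0$ with $\mathrm{KSD}_{p'}(\nu)\le C$ for every probability measure $\nu$ on $\Theta$ with $\int\|\theta\|\,d\nu\le R$ (if $\Theta$ lies in the closed ball of radius $R$ about $0$, these are all the probability measures on $\Theta$). 3. Let $B$ be any constant as in 1, $C$ any constant as in 2, $\alpha>1$, and $$0<\zeta\le\frac{\alpha-1}{\alpha B\sqrt C},\qquad \zeta<\frac{2}{(\alpha^2+L)B^2},\qquad c_\zeta=\zeta\Big(1-\frac{\zeta(\alpha^2+L)B^2}{2}\Big)$$ (such $\zeta$ exist). Then $c_\zeta>0$. Moreover, let $N\ge1$ be such that the iterates $\mu_0,\dots,\mu_{N+1}$ with step size $\zeta$ are all concentrated on $\Theta$ (automatic if $\Theta=\mathbb R^d$), and assume that $\Theta$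 is contained in the closed ball of radius $R$ about $0$ or, more generally, that $\int\|\theta\|\,d\mu_t\le R$ for all $t\le N+1$. Then $$\frac1N\sum_{i=1}^N\mathrm{KSD}_{p'}(\mu_i)\ \le\ \frac{D_{KL}(p\,\|\,p')}{N\,c_\zeta},$$ where the right-hand side may be $+\infty$. -/

import Mathlib

open MeasureTheory Finset
open scoped ENNReal NNReal

namespace SVGD

/-- The ambient space `ℝᵈ` of parameters, with its Euclidean norm. -/
abbrev Param (d : ℕ) := EuclideanSpace ℝ (Fin d)

/-! ### The RBF kernel and its reproducing kernel Hilbert space -/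

/-- The RBF kernel `k(x, y) = exp(-‖x - y‖² / h)` with bandwidth `h`. -/
noncomputable def rbf (d : ℕ) (h : ℝ≥0) (x y : Param d) : ℝ :=
  Real.exp (-‖x - y‖ ^ 2 / h)

/-- The RBF kernel in the format of Mathlib's reproducing kernel Hilbert spaces: a matrix indexed by
`ℝᵈ` whose entries are the scalars `k(x, y)`, seen as operators on `ℝ`. -/
noncomputable def rbfMatrix (d : ℕ) (h : ℝ≥0) : Matrix (Param d) (Param d) (ℝ →L[ℝ] ℝ) :=
  Matrix.of fun x y => rbf d h x y • ContinuousLinearMap.id ℝ ℝ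

lemma rbf_eq_integral_cos (d : ℕ) (h : ℝ≥0) (x y : Param d) :
    rbf d h x y = ∫ ξ, Real.cos (inner ℝ ξ (Real.sqrt (2 / h) • x)
      - inner ℝ ξ (Real.sqrt (2 / h) • y)) ∂(ProbabilityTheory.stdGaussian (Param d)) := by
  have h1 := ProbabilityTheory.charFun_stdGaussian (E := Param d) (Real.sqrt (2 / h) • (x - y))
  rw [charFun_apply] at h1
  have h2 := congrArg Complex.re h1
  rw [← RCLike.re_eq_complex_re, ← integral_re] at h2
  · have h3 : ∀ ξ : Param d, RCLike.re (Complex.exp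
        ((inner ℝ ξ (Real.sqrt (2 / h) • (x - y)) : ℝ) * Complex.I))
        = Real.cos (inner ℝ ξ (Real.sqrt (2 / h) • x)
          - inner ℝ ξ (Real.sqrt (2 / h) • y)) := by
      intro ξ
      rw [RCLike.re_eq_complex_re, Complex.exp_ofReal_mul_I_re, smul_sub, inner_sub_right]
    simp only [h3] at h2
    have h4 : (-(‖Real.sqrt (2 / h) • (x - y)‖ : ℂ) ^ 2 / 2)
        = ((-‖x - y‖ ^ 2 / h : ℝ) : ℂ) := by
      have h5 : -‖Real.sqrt (2 / h) • (x - y)‖ ^ 2 / 2 = -‖x - y‖ ^ 2 / h := by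
        rw [norm_smul, mul_pow, Real.norm_eq_abs, sq_abs, Real.sq_sqrt (by positivity)]
        ring
      rw [← h5]
      push_cast
      rfl
    rw [h2, rbf, h4, ← Complex.ofReal_exp, RCLike.re_eq_complex_re, Complex.ofReal_re]
  · refine Integrable.of_bound (C := 1) (by fun_prop) (ae_of_all _ fun ξ => ?_)
    rw [Complex.norm_exp_ofReal_mul_I]

/-- The RBF kernel is positive semidefinite. -/
instance fact_posSemidef_rbfMatrix (d : ℕ) (h : ℝ≥0) : Fact (rbfMatrix d h).PosSemidef := by
  have key := (RKHS.posSemidef_tfae (K := rbfMatrix d h)).out 0 2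
  refine ⟨key.mpr ⟨?_, fun v => ?_⟩⟩
  · have h1 : star (ContinuousLinearMap.id ℝ ℝ) = ContinuousLinearMap.id ℝ ℝ :=
      star_one (ℝ →L[ℝ] ℝ)
    ext x y
    simp [rbfMatrix, rbf, norm_sub_rev, Matrix.conjTranspose_apply, h1]
  · have hint : ∀ x y : Param d, Integrable (fun ξ => Real.cos
        (inner ℝ ξ (Real.sqrt (2 / h) • x) - inner ℝ ξ (Real.sqrt (2 / h) • y)))
        (ProbabilityTheory.stdGaussian (Param d)) := fun x y =>
      Integrable.of_bound (C := 1) (by fun_prop)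
        (ae_of_all _ fun ξ => by simpa using Real.abs_cos_le_one _)
    have hsum : (v.sum fun x w => v.sum fun x' w' => inner ℝ (rbfMatrix d h x' x w) w')
        = ∫ ξ, ((∑ x ∈ v.support, v x * Real.cos (inner ℝ ξ (Real.sqrt (2 / h) • x))) ^ 2
          + (∑ x ∈ v.support, v x * Real.sin (inner ℝ ξ (Real.sqrt (2 / h) • x))) ^ 2)
            ∂(ProbabilityTheory.stdGaussian (Param d)) := by
      have e : ∀ ξ : Param d,
          (∑ x ∈ v.support, v x * Real.cos (inner ℝ ξ (Real.sqrt (2 / h) • x))) ^ 2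
          + (∑ x ∈ v.support, v x * Real.sin (inner ℝ ξ (Real.sqrt (2 / h) • x))) ^ 2
          = ∑ x ∈ v.support, ∑ x' ∈ v.support, (v x * v x') * Real.cos
            (inner ℝ ξ (Real.sqrt (2 / h) • x') - inner ℝ ξ (Real.sqrt (2 / h) • x)) := by
        intro ξ
        rw [sq, sq, Finset.sum_mul_sum, Finset.sum_mul_sum, ← Finset.sum_add_distrib]
        refine Finset.sum_congr rfl fun x _ => ?_
        rw [← Finset.sum_add_distrib]
        refine Finset.sum_congr rfl fun x' _ => ?_
        rw [Real.cos_sub]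
        ring
      simp only [e]
      rw [integral_finsetSum _ fun x _ => integrable_finsetSum _ fun x' _ =>
        (hint x' x).const_mul _]
      simp only [Finsupp.sum]
      refine Finset.sum_congr rfl fun x _ => ?_
      rw [integral_finsetSum _ fun x' _ => (hint x' x).const_mul _]
      refine Finset.sum_congr rfl fun x' _ => ?_
      rw [integral_const_mul, ← rbf_eq_integral_cos]
      simp [rbfMatrix]
      ring
    rw [hsum]
    exact integral_nonneg fun ξ => by positivity

/-- The reproducing kernel Hilbert space `ℋ` of the RBF kernel. -/
abbrev RBFSpace (d : ℕ) (h : ℝ≥0) := RKHS.OfKernel (rbfMatrix d h)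

/-- The product space `ℋᵈ`, with the norm `‖f‖² = ∑ᵢ ‖fᵢ‖²`. -/
abbrev RBFSpaceVec (d : ℕ) (h : ℝ≥0) := PiLp 2 fun _ : Fin d => RBFSpace d h

/-- The element `k(θ, ·)` of `ℋ`. -/
noncomputable def feature (d : ℕ) (h : ℝ≥0) (θ : Param d) : RBFSpace d h :=
  RKHS.kerFun (RBFSpace d h) θ 1

lemma feature_apply (d : ℕ) (h : ℝ≥0) (θ x : Param d) : feature d h θ x = rbf d h x θ := by
  rw [feature, RKHS.kerFun_apply, RKHS.OfKernel.kernel_ofKernel]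
  simp [rbfMatrix]

/-- The element `∇_θ k(θ, ·)` of `ℋᵈ`, the tuple of the partial derivatives of `θ ↦ k(θ, ·)`. -/
noncomputable def featureGradient (d : ℕ) (h : ℝ≥0) (θ : Param d) : RBFSpaceVec d h :=
  WithLp.toLp 2 fun i => fderiv ℝ (feature d h) θ (EuclideanSpace.single i 1)

/-! ### Prior, potential and posterior -/

/-- The potential `V = -δL - log p`. -/
noncomputable def potential {d : ℕ} (δL p : Param d → ℝ) (θ : Param d) : ℝ :=
  -δL θ - Real.log (p θ)

/-- The posterior density `p'(θ) = exp(-V(θ)) / z = exp(δL(θ)) p(θ) / z` on `Θ`, with the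
normalizing constant `z = ∫_Θ exp(-V)`. -/
noncomputable def posterior {d : ℕ} (Θ : Set (Param d)) (δL p : Param d → ℝ) (θ : Param d) : ℝ :=
  Real.exp (-potential δL p θ) / ∫ ν in Θ, Real.exp (-potential δL p ν)

/-- The measure on `Θ` with Lebesgue density `q`. -/
noncomputable def densityMeasure {d : ℕ} (Θ : Set (Param d)) (q : Param d → ℝ) :
    Measure (Param d) :=
  (volume.restrict Θ).withDensity fun θ => ENNReal.ofReal (q θ)

/-! ### Stein variational gradient descent -/

/-- The SVGD direction `φ*_μ = 𝔼_{θ ∼ μ}[k(θ, ·) ∇ log q(θ) + ∇_θ k(θ, ·)] ∈ ℋᵈ` for the target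
density `q`, as an integral in `ℋᵈ`. -/
noncomputable def steinDirection {d : ℕ} (h : ℝ≥0) (q : Param d → ℝ) (μ : Measure (Param d)) :
    RBFSpaceVec d h :=
  ∫ θ, (WithLp.toLp 2 (fun i : Fin d => gradient (fun ν => Real.log (q ν)) θ i • feature d h θ)
    + featureGradient d h θ) ∂μ

/-- The kernel Stein discrepancy `KSD_q(μ) = ‖φ*_μ‖²_{ℋᵈ}`. -/
noncomputable def ksd {d : ℕ} (h : ℝ≥0) (q : Param d → ℝ) (μ : Measure (Param d)) : ℝ :=
  ‖steinDirection h q μ‖ ^ 2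

/-- The SVGD transport map `θ ↦ θ + ζ φ*_μ(θ)` with step size `ζ`. -/
noncomputable def svgdMap {d : ℕ} (h : ℝ≥0) (q : Param d → ℝ) (ζ : ℝ) (μ : Measure (Param d))
    (θ : Param d) : Param d :=
  θ + ζ • WithLp.toLp 2 fun i : Fin d => steinDirection h q μ i θ

/-- The SVGD iterates: `μ₀` is given and `μₜ₊₁` is the image of `μₜ` under the transport map. -/
noncomputable def svgdIterate {d : ℕ} (h : ℝ≥0) (q : Param d → ℝ) (ζ : ℝ)
    (μ₀ : Measure (Param d)) : ℕ → Measure (Param d)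
  | 0 => μ₀
  | t + 1 => (svgdIterate h q ζ μ₀ t).map (svgdMap h q ζ (svgdIterate h q ζ μ₀ t))

/-- `B` is a positive bound on `‖k(θ, ·)‖_ℋ` and `‖∇_θ k(θ, ·)‖_{ℋᵈ}` for `θ ∈ Θ`. -/
def KernelBound {d : ℕ} (h : ℝ≥0) (Θ : Set (Param d)) (B : ℝ) : Prop :=
  0 < B ∧ ∀ θ ∈ Θ, ‖feature d h θ‖ ≤ B ∧ ‖featureGradient d h θ‖ ≤ B

/-- `C` is a positive bound on `KSD_q(ν)` for all probability measures `ν` on `Θ` whose first moment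
is at most `R` (for `Θ` inside the closed ball of radius `R`: all probability measures on `Θ`). -/
def KSDBound {d : ℕ} (h : ℝ≥0) (q : Param d → ℝ) (Θ : Set (Param d)) (R : ℝ≥0) (C : ℝ) : Prop :=
  0 < C ∧ ∀ ν : Measure (Param d), IsProbabilityMeasure ν → ν Θᶜ = 0 → ∫⁻ θ, ‖θ‖ₑ ∂ν ≤ R →
    ksd h q ν ≤ C

/-- The constant `c_ζ = ζ (1 - ζ (α² + L) B² / 2)`. -/
noncomputable def stepConst (α B L ζ : ℝ) : ℝ :=
  ζ * (1 - ζ * (α ^ 2 + L) * B ^ 2 / 2)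

end SVGD

/-! SVGD is a descent method for the Kullback-Leibler divergence to the posterior, and the KSD is
the rate of descent. Let `φ` be the direction at `μ` and `T = id + ζ φ`. Change of variables gives,
for `μ`-almost every `x`, that the log-likelihood ratio of `T_# μ` at `T x` minus that of `μ` at `x`
equals `V (T x) - V x - log |det DT x|` (`llr_map_of_hasFDerivAt`). Its part of first order in `ζ`
is `-ζ (⟪-∇V, φ⟫ + div φ)`, and the reproducing property makes the `μ`-mean of the bracket equal to
`‖φ‖²`, the KSD (`norm_sq_integral_steinFeature`).

The second-order error is uniform in `x`: the Lipschitz gradient of `V` contributes at most `L B²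
‖φ‖² ζ² / 2` (`abs_sub_sub_inner_gradient_le`), and the log-determinant at most `α B² ‖φ‖² ζ² / 2`
(`abs_log_det_sub_trace_le`). So a step lowers the divergence by at least `c_ζ` times the KSD
(`klDiv_map_transport_add_le`), and the sum over the steps telescopes.

The expansion needs the feature map `θ ↦ k(θ, ·)` to be `C¹` into `ℋ`. This follows from explicit
bounds on its first and second differences. Translation invariance extends the constant `B` from `Θ`
to `ℝᵈ`, so `T` is injective with invertible derivative everywhere once `ζ B ‖φ‖ < 1`. The KSD bound
holds because a Lipschitz score grows at most linearly, so a first moment controls it. -/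

namespace SVGD

/-! ### Differentiability from bounds on second differences -/

section SecondDifference

variable {E H : Type*} [NormedAddCommGroup E] [NormedSpace ℝ E]
  [NormedAddCommGroup H] [NormedSpace ℝ H]

/-- The dyadic difference quotients of `f` at `x` in direction `u`. -/
noncomputable def dyadicQuotient (f : E → H) (x u : E) (n : ℕ) : H :=
  (2 : ℝ) ^ n • (f (x + ((2 : ℝ) ^ n)⁻¹ • u) - f x)

lemma dist_dyadicQuotient_succ_le {f : E → H} {M : ℝ}
    (hM : ∀ x u v, ‖f (x + u + v) - f (x + u) - f (x + v) + f x‖ ≤ M * ‖u‖ * ‖v‖)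
    (x u : E) (n : ℕ) :
    dist (dyadicQuotient f x u n) (dyadicQuotient f x u (n + 1)) ≤ M * ‖u‖ ^ 2 / 2 / 2 / 2 ^ n := by
  set w : E := ((2 : ℝ) ^ (n + 1))⁻¹ • u with hw
  have h1 : ((2 : ℝ) ^ n)⁻¹ • u = w + w := by
    rw [hw, ← add_smul, pow_succ]
    congr 1
    field_simp
    norm_num
  -- Halving the step changes the quotient by a rescaled second difference with both increments
  -- equal to `w`.
  have h2 : dyadicQuotient f x u n - dyadicQuotient f x u (n + 1)
      = (2 : ℝ) ^ n • (f (x + w + w) - f (x + w) - f (x + w) + f x) := by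
    simp only [dyadicQuotient, h1, ← hw]
    rw [pow_succ, mul_smul, ← smul_sub, two_smul, add_assoc]
    congr 1
    abel
  have h3 : ‖w‖ = ((2 : ℝ) ^ (n + 1))⁻¹ * ‖u‖ := by
    rw [hw, norm_smul, Real.norm_of_nonneg (by positivity)]
  rw [dist_eq_norm, h2, norm_smul, Real.norm_of_nonneg (by positivity)]
  calc (2 : ℝ) ^ n * ‖f (x + w + w) - f (x + w) - f (x + w) + f x‖
      ≤ (2 : ℝ) ^ n * (M * ‖w‖ * ‖w‖) := by gcongr; exact hM x w w
    _ = M * ‖u‖ ^ 2 / 2 / 2 / 2 ^ n := by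
      rw [h3, pow_succ]
      field_simp

/-- A Lipschitz map whose second differences are bounded by `M ‖u‖ ‖v‖` is continuously
differentiable. -/
theorem exists_hasFDerivAt_of_secondDifference_le [CompleteSpace H] {f : E → H} {K M : ℝ}
    (hK : ∀ x u, ‖f (x + u) - f x‖ ≤ K * ‖u‖)
    (hM : ∀ x u v, ‖f (x + u + v) - f (x + u) - f (x + v) + f x‖ ≤ M * ‖u‖ * ‖v‖) :
    ∃ D : E → E →L[ℝ] H, Continuous D ∧ ∀ x, HasFDerivAt f (D x) x := by
  have hM0 : ∀ u v : E, 0 ≤ M * ‖u‖ * ‖v‖ := fun u v => (norm_nonneg _).trans (hM 0 u v)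
  have hpow : ∀ n : ℕ, (0 : ℝ) < 2 ^ n := fun n => by positivity
  have hq_norm : ∀ (n : ℕ) (u : E), ‖((2 : ℝ) ^ n)⁻¹ • u‖ = ((2 : ℝ) ^ n)⁻¹ * ‖u‖ := fun n u => by
    rw [norm_smul, Real.norm_of_nonneg (by positivity)]
  have hinv : Filter.Tendsto (fun n : ℕ => ((2 : ℝ) ^ n)⁻¹) Filter.atTop (nhds 0) := by
    exact tendsto_inv_atTop_zero.comp (tendsto_pow_atTop_atTop_of_one_lt (r := (2 : ℝ))
      (by norm_num))
  choose d hd using fun x u => cauchySeq_tendsto_of_complete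
    (cauchySeq_of_le_geometric_two (dist_dyadicQuotient_succ_le hM x u))
  -- The quotient at `n = 0` is `f (x + u) - f x`; the geometric series of the later corrections
  -- sums to `M ‖u‖² / 2`, which is the Taylor remainder.
  have hd0 : ∀ x u, ‖f (x + u) - f x - d x u‖ ≤ M * ‖u‖ ^ 2 / 2 := by
    intro x u
    have := dist_le_of_le_geometric_two_of_tendsto₀
      (dist_dyadicQuotient_succ_le hM x u) (hd x u)
    rw [dist_eq_norm] at this
    simpa [dyadicQuotient] using this
  have hdK : ∀ x u, ‖d x u‖ ≤ K * ‖u‖ := by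
    intro x u
    refine le_of_tendsto (hd x u).norm (Filter.Eventually.of_forall fun n => ?_)
    rw [dyadicQuotient, norm_smul, Real.norm_of_nonneg (hpow n).le]
    calc (2 : ℝ) ^ n * ‖f (x + ((2 : ℝ) ^ n)⁻¹ • u) - f x‖
        ≤ (2 : ℝ) ^ n * (K * ‖((2 : ℝ) ^ n)⁻¹ • u‖) := by gcongr; exact hK _ _
      _ = K * ‖u‖ := by rw [hq_norm]; field_simp
  have hadd : ∀ x u v, d x (u + v) = d x u + d x v := by
    intro x u v
    -- The defect of additivity at level `n` is `2ⁿ` times a second difference of size `4⁻ⁿ`, so it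
    -- vanishes in the limit.
    have h1 := (hd x (u + v)).sub ((hd x u).add (hd x v))
    have h2 : Filter.Tendsto (fun n => dyadicQuotient f x (u + v) n
        - (dyadicQuotient f x u n + dyadicQuotient f x v n)) Filter.atTop (nhds 0) := by
      refine squeeze_zero_norm (a := fun n : ℕ => M * ‖u‖ * ‖v‖ * ((2 : ℝ) ^ n)⁻¹) (fun n => ?_) ?_
      · have h3 : dyadicQuotient f x (u + v) n - (dyadicQuotient f x u n + dyadicQuotient f x v n)
            = (2 : ℝ) ^ n • (f (x + ((2 : ℝ) ^ n)⁻¹ • u + ((2 : ℝ) ^ n)⁻¹ • v)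
              - f (x + ((2 : ℝ) ^ n)⁻¹ • u) - f (x + ((2 : ℝ) ^ n)⁻¹ • v) + f x) := by
          simp only [dyadicQuotient]
          rw [← smul_add, ← smul_sub, smul_add, add_assoc]
          congr 1
          abel
        rw [h3, norm_smul, Real.norm_of_nonneg (hpow n).le]
        refine (mul_le_mul_of_nonneg_left (hM _ _ _) (hpow n).le).trans (le_of_eq ?_)
        rw [hq_norm, hq_norm]
        field_simp
      · simpa using hinv.const_mul (M * ‖u‖ * ‖v‖)
    exact sub_eq_zero.mp (tendsto_nhds_unique h1 h2)
  have hdiff : ∀ x v u, ‖d (x + v) u - d x u‖ ≤ M * ‖v‖ * ‖u‖ := by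
    intro x v u
    refine le_of_tendsto ((hd (x + v) u).sub (hd x u)).norm
      (Filter.Eventually.of_forall fun n => ?_)
    have h3 : dyadicQuotient f (x + v) u n - dyadicQuotient f x u n
        = (2 : ℝ) ^ n • (f (x + v + ((2 : ℝ) ^ n)⁻¹ • u)
          - f (x + v) - f (x + ((2 : ℝ) ^ n)⁻¹ • u) + f x) := by
      simp only [dyadicQuotient]
      rw [← smul_sub]
      congr 1
      abel
    rw [h3, norm_smul, Real.norm_of_nonneg (hpow n).le]
    refine (mul_le_mul_of_nonneg_left (hM _ _ _) (hpow n).le).trans (le_of_eq ?_)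
    rw [hq_norm]
    field_simp
  have hd00 : ∀ x, d x 0 = 0 := fun x => by simpa using hadd x 0 0
  let A : E → E →+ H := fun x => ⟨⟨d x, hd00 x⟩, hadd x⟩
  have hcont : ∀ x, Continuous (A x) := fun x =>
    AddMonoidHomClass.continuous_of_bound (A x) K (hdK x)
  let D : E → E →L[ℝ] H := fun x => (A x).toRealLinearMap (hcont x)
  have hD : ∀ x u, D x u = d x u := fun x u => rfl
  refine ⟨D, ?_, fun x => ?_⟩
  -- The hypothesis forces `M ≥ 0` only when `E` has a nonzero vector.
  · rcases subsingleton_or_nontrivial E with hE | hE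
    · exact continuous_of_const fun x y => by rw [Subsingleton.elim x y]
    · obtain ⟨e, he⟩ := exists_ne (0 : E)
      have hMnn : 0 ≤ M := by
        have := hM0 e e
        have h2 : 0 < ‖e‖ * ‖e‖ := by positivity
        rw [mul_assoc] at this
        exact nonneg_of_mul_nonneg_left this h2
      refine (LipschitzWith.of_dist_le_mul (K := ⟨M, hMnn⟩) fun x y => ?_).continuous
      rw [dist_eq_norm, dist_eq_norm]
      refine ContinuousLinearMap.opNorm_le_bound _ (by positivity) fun u => ?_
      have := hdiff y (x - y) u
      rw [add_sub_cancel] at this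
      exact this
  · rw [hasFDerivAt_iff_isLittleO_nhds_zero]
    refine Asymptotics.IsBigO.trans_isLittleO (g := fun u : E => ‖u‖ ^ 2) ?_ ?_
    · refine Asymptotics.IsBigO.of_bound (M / 2) (Filter.Eventually.of_forall fun u => ?_)
      rw [hD, Real.norm_of_nonneg (by positivity)]
      refine (hd0 x u).trans (le_of_eq (by ring))
    · exact Asymptotics.isLittleO_norm_pow_id one_lt_two

end SecondDifference

/-- A function whose derivative stays within `K s` of `m` stays within `K b² / 2` of its
linearization. -/
lemma abs_sub_sub_mul_le_of_deriv {g g' : ℝ → ℝ} {b m K : ℝ} (hb : 0 ≤ b)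
    (hg : ∀ s ∈ Set.Icc 0 b, HasDerivWithinAt g (g' s) (Set.Icc 0 b) s)
    (hg' : ∀ s ∈ Set.Icc 0 b, |g' s - m| ≤ K * s) :
    |g b - g 0 - b * m| ≤ K * b ^ 2 / 2 := by
  have h1 := image_norm_le_of_norm_deriv_right_le_deriv_boundary
    (f := fun s => g s - g 0 - s * m) (f' := fun s => g' s - m) (a := 0) (b := b)
    (B := fun s => K * s ^ 2 / 2) (B' := fun s => K * s) ?_ ?_ (by simp) ?_ ?_
    (Set.right_mem_Icc.mpr hb)
  · simpa using h1
  · refine ContinuousOn.sub (ContinuousOn.sub (fun s hs => (hg s hs).continuousWithinAt)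
      continuousOn_const) (by fun_prop)
  · intro s hs
    have h2 : HasDerivWithinAt g (g' s) (Set.Ici s) s :=
      (hg s (Set.Ico_subset_Icc_self hs)).mono_of_mem_nhdsWithin
        (Filter.mem_of_superset (Icc_mem_nhdsGE hs.2)
          (Set.Icc_subset_Icc_left hs.1))
    exact ((h2.sub_const (g 0)).sub ((hasDerivWithinAt_id s _).mul_const m)).congr_deriv (by simp)
  · intro s
    have := ((hasDerivAt_pow 2 s).const_mul K).div_const 2
    refine this.congr_deriv ?_
    push_cast
    ring
  · intro s hs
    exact hg' s (Set.Ico_subset_Icc_self hs)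

/-! ### The log-determinant near the identity, and the descent inequality -/

section LogDet

variable {n : Type*} [Fintype n] [DecidableEq n]

attribute [local instance] Matrix.frobeniusNormedRing Matrix.frobeniusNormedAddCommGroup
  Matrix.frobeniusNormedSpace

lemma frobenius_sq (A : Matrix n n ℝ) : ‖A‖ ^ 2 = ∑ i, ∑ j, A i j ^ 2 := by
  rw [Matrix.frobenius_norm_def, ← Real.sqrt_eq_rpow, Real.sq_sqrt (by positivity)]
  simp

lemma abs_trace_mul_le (A X : Matrix n n ℝ) : |(A * X).trace| ≤ ‖A‖ * ‖X‖ := by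
  refine abs_le_of_sq_le_sq ?_ (by positivity)
  rw [mul_pow, frobenius_sq A, ← Matrix.frobenius_norm_transpose X, frobenius_sq]
  simp only [Matrix.trace, Matrix.diag, Matrix.mul_apply, Matrix.transpose_apply]
  simp only [← Finset.sum_product']
  exact Finset.sum_mul_sq_le_sq_mul_sq _ _ _

lemma isUnit_one_add_of_norm_lt_one {A : Matrix n n ℝ} (hA : ‖A‖ < 1) : IsUnit (1 + A) := by
  have := isUnit_one_sub_of_norm_lt_one (x := -A) (by rwa [norm_neg])
  rwa [sub_neg_eq_add] at this

lemma hasDerivAt_det_one_add_smul (A : Matrix n n ℝ) :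
    HasDerivAt (fun t : ℝ => (1 + t • A).det) A.trace 0 := by
  have h1 : (fun t : ℝ => (1 + t • A).det)
      = fun t => (Matrix.det (1 + (Polynomial.X : Polynomial ℝ) • A.map Polynomial.C)).eval t := by
    funext t
    rw [← Polynomial.coe_evalRingHom, RingHom.map_det]
    congr 1
    ext i j
    simp [Matrix.one_apply, apply_ite]
    exact mul_comm _ _
  rw [h1, ← Matrix.derivative_det_one_add_X_smul]
  exact Polynomial.hasDerivAt _ _

/-- Jacobi's formula along the segment from the identity in direction `A`. -/
lemma hasDerivAt_log_det_one_add_smul {A : Matrix n n ℝ} {s : ℝ} (h : IsUnit (1 + s • A)) :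
    HasDerivAt (fun t : ℝ => Real.log (1 + t • A).det) (((1 + s • A)⁻¹ * A).trace) s := by
  have hdet : (1 + s • A).det ≠ 0 := ((Matrix.isUnit_iff_isUnit_det _).mp h).ne_zero
  -- Factoring out `1 + s A` moves the base point to the identity, where the derivative of the
  -- determinant is the trace.
  have h1 : ∀ t : ℝ, (1 + t • A).det
      = (1 + s • A).det * (1 + (t - s) • ((1 + s • A)⁻¹ * A)).det := by
    intro t
    rw [← Matrix.det_mul, mul_add, mul_one, mul_smul_comm,
      Matrix.mul_nonsing_inv_cancel_left _ _ ((Matrix.isUnit_iff_isUnit_det _).mp h), sub_smul]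
    congr 1
    abel
  have h2 : HasDerivAt (fun t : ℝ => (1 + t • A).det)
      ((1 + s • A).det * ((1 + s • A)⁻¹ * A).trace) s := by
    have h3 := hasDerivAt_det_one_add_smul ((1 + s • A)⁻¹ * A)
    rw [← sub_self s] at h3
    have h4 := (h3.comp_sub_const s s).const_mul (1 + s • A).det
    exact h4.congr_of_eventuallyEq (Filter.Eventually.of_forall h1)
  exact (h2.log hdet).congr_deriv (by field_simp)

/-- Second-order control of `log det` near the identity in terms of the Frobenius norm. -/
theorem abs_log_det_sub_trace_le {A : Matrix n n ℝ} {a α ζ : ℝ} (hα : 1 < α) (hζ : 0 ≤ ζ)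
    (ha : ∑ i, ∑ j, A i j ^ 2 ≤ a ^ 2) (ha0 : 0 ≤ a) (hζa : ζ * a ≤ (α - 1) / α) :
    (1 + ζ • A).det ≠ 0 ∧
      |Real.log (1 + ζ • A).det - ζ * A.trace| ≤ α * a ^ 2 * ζ ^ 2 / 2 := by
  have hAa : ‖A‖ ≤ a := abs_le_of_sq_le_sq' (by rwa [frobenius_sq]) ha0 |>.2
  have hα0 : 0 < α := by linarith
  have hlt : (α - 1) / α < 1 := by rw [div_lt_one hα0]; linarith
  have hsmall : ∀ s ∈ Set.Icc 0 ζ, ‖s • A‖ ≤ (α - 1) / α := by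
    intro s hs
    rw [norm_smul, Real.norm_of_nonneg hs.1]
    exact (mul_le_mul hs.2 hAa (norm_nonneg _) hζ).trans hζa
  have hunit : ∀ s ∈ Set.Icc 0 ζ, IsUnit (1 + s • A) := fun s hs =>
    isUnit_one_add_of_norm_lt_one ((hsmall s hs).trans_lt hlt)
  refine ⟨((Matrix.isUnit_iff_isUnit_det _).mp
    (hunit ζ (Set.right_mem_Icc.mpr hζ))).ne_zero, ?_⟩
  have key := abs_sub_sub_mul_le_of_deriv (g := fun t : ℝ => Real.log (1 + t • A).det)
    (g' := fun s => ((1 + s • A)⁻¹ * A).trace) (m := A.trace) (K := α * a ^ 2) hζ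
    (fun s hs => (hasDerivAt_log_det_one_add_smul (hunit s hs)).hasDerivWithinAt) ?_
  · simpa using key
  intro s hs
  set X := (1 + s • A)⁻¹ * A with hX
  -- This resolvent identity serves twice: it bounds `‖X‖` by absorbing `s A X`, since `‖s A‖ ≤ 1 -
  -- 1/α`, and it writes `tr X - tr A` as `-s tr (A X)`.
  have hXA : X + s • (A * X) = A := by
    have : (1 + s • A) * X = A := Matrix.mul_nonsing_inv_cancel_left _ _
      ((Matrix.isUnit_iff_isUnit_det _).mp (hunit s hs))
    rwa [add_mul, one_mul, smul_mul_assoc] at this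
  have hXn : ‖X‖ ≤ α * a := by
    have h1 : ‖X‖ ≤ ‖A‖ + ‖s • A‖ * ‖X‖ := by
      calc ‖X‖ = ‖A - s • A * X‖ := by rw [smul_mul_assoc]; congr 1; exact eq_sub_of_add_eq hXA
        _ ≤ ‖A‖ + ‖s • A * X‖ := norm_sub_le _ _
        _ ≤ _ := by gcongr; exact norm_mul_le _ _
    have h2 : ‖s • A‖ * ‖X‖ ≤ (α - 1) / α * ‖X‖ := by gcongr; exact hsmall s hs
    have h3 : (α - 1) / α = 1 - α⁻¹ := by field_simp
    rw [h3] at h2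
    have h4 : α⁻¹ * ‖X‖ ≤ a := by linarith
    calc ‖X‖ = α * (α⁻¹ * ‖X‖) := by field_simp
      _ ≤ α * a := by gcongr
  have h5 : X.trace - A.trace = -(s * (A * X).trace) := by
    have := congrArg Matrix.trace hXA
    rw [Matrix.trace_add, Matrix.trace_smul, smul_eq_mul] at this
    linarith
  rw [h5, abs_neg, abs_mul, abs_of_nonneg hs.1]
  calc s * |(A * X).trace| ≤ s * (a * (α * a)) := by
        have := hs.1
        gcongr
        exact (abs_trace_mul_le A X).trans (by gcongr)
    _ = α * a ^ 2 * s := by ring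

end LogDet

/-- The descent inequality for a function with Lipschitz gradient. -/
theorem abs_sub_sub_inner_gradient_le {E : Type*} [NormedAddCommGroup E] [InnerProductSpace ℝ E]
    [CompleteSpace E] {Θ : Set E} (hΘ_open : IsOpen Θ) (hΘ_convex : Convex ℝ Θ) {V : E → ℝ}
    {L : ℝ≥0} (hV : DifferentiableOn ℝ V Θ) (hL : LipschitzOnWith L (gradient V) Θ)
    {x y : E} (hx : x ∈ Θ) (hy : y ∈ Θ) :
    |V y - V x - inner ℝ (gradient V x) (y - x)| ≤ L / 2 * ‖y - x‖ ^ 2 := by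
  have hmem : ∀ s ∈ Set.Icc (0 : ℝ) 1, x + s • (y - x) ∈ Θ := fun s hs =>
    hΘ_convex.add_smul_sub_mem hx hy hs
  have key := abs_sub_sub_mul_le_of_deriv (g := fun s : ℝ => V (x + s • (y - x)))
    (g' := fun s => inner ℝ (gradient V (x + s • (y - x))) (y - x))
    (m := inner ℝ (gradient V x) (y - x)) (K := L * ‖y - x‖ ^ 2) zero_le_one (fun s hs => ?_)
    fun s hs => ?_
  · simp only [one_smul, add_sub_cancel, zero_smul, add_zero, one_mul, one_pow, mul_one] at key
    exact key.trans (le_of_eq (by ring))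
  · have h1 : HasFDerivAt V (fderiv ℝ V (x + s • (y - x))) (x + s • (y - x)) :=
      (hV.differentiableAt (hΘ_open.mem_nhds (hmem s hs))).hasFDerivAt
    have h2 : HasDerivAt (fun s : ℝ => x + s • (y - x)) (y - x) s := by
      simpa using ((hasDerivAt_id s).smul_const (y - x)).const_add x
    refine (h1.comp_hasDerivAt s h2).hasDerivWithinAt.congr_deriv ?_
    rw [gradient, InnerProductSpace.toDual_symm_apply]
  · rw [← inner_sub_left]
    have h1 := hL.dist_le_mul _ (hmem s hs) _ hx
    rw [dist_eq_norm, dist_eq_norm, add_sub_cancel_left, norm_smul,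
      Real.norm_of_nonneg hs.1] at h1
    calc _ ≤ ‖gradient V (x + s • (y - x)) - gradient V x‖ * ‖y - x‖ := abs_real_inner_le_norm _ _
      _ ≤ L * (s * ‖y - x‖) * ‖y - x‖ := by gcongr
      _ = L * ‖y - x‖ ^ 2 * s := by ring

/-! ### Regularity and translation invariance of the feature map -/

section Kernel

variable {d : ℕ} {h : ℝ≥0}

lemma inner_feature_left (x : Param d) (f : RBFSpace d h) : inner ℝ (feature d h x) f = f x := by
  rw [feature, RKHS.kerFun_inner]
  simp

lemma inner_feature_feature (x y : Param d) :
    inner ℝ (feature d h x) (feature d h y) = rbf d h x y := by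
  rw [inner_feature_left, feature_apply]

lemma rbf_self (x : Param d) : rbf d h x x = 1 := by simp [rbf]

lemma norm_feature (x : Param d) : ‖feature d h x‖ = 1 := by
  have := real_inner_self_eq_norm_sq (feature d h x)
  rw [inner_feature_feature, rbf_self] at this
  nlinarith [norm_nonneg (feature d h x)]

lemma norm_feature_add_sub_sq (x u : Param d) :
    ‖feature d h (x + u) - feature d h x‖ ^ 2 = 2 - 2 * Real.exp (-‖u‖ ^ 2 / h) := by
  rw [norm_sub_sq_real, norm_feature, norm_feature, inner_feature_feature, rbf,
    add_sub_cancel_left]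
  ring

lemma one_sub_exp_neg_le (u : Param d) : 1 - Real.exp (-‖u‖ ^ 2 / h) ≤ ‖u‖ ^ 2 / h := by
  have := Real.add_one_le_exp (-‖u‖ ^ 2 / h)
  rw [neg_div] at this ⊢
  linarith

lemma one_sub_exp_neg_nonneg (u : Param d) : 0 ≤ 1 - Real.exp (-‖u‖ ^ 2 / h) := by
  rw [sub_nonneg, Real.exp_le_one_iff, neg_div]
  have : 0 ≤ ‖u‖ ^ 2 / h := by positivity
  linarith

lemma norm_feature_add_sub_le (x u : Param d) :
    ‖feature d h (x + u) - feature d h x‖ ≤ Real.sqrt (2 / h) * ‖u‖ := by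
  refine abs_le_of_sq_le_sq' ?_ (by positivity) |>.2
  rw [norm_feature_add_sub_sq, mul_pow, Real.sq_sqrt (by positivity)]
  have := one_sub_exp_neg_le (h := h) u
  calc _ ≤ 2 * (‖u‖ ^ 2 / h) := by linarith
    _ = _ := by ring

/-- Combine `cosh w ≤ exp (w²/2)` with `1 - w²/2 ≤ exp (-w²/2)`. The factor `cosh w` on the right is
harmless later, where two Gaussian factors absorb it. -/
lemma cosh_sub_one_le (w : ℝ) : Real.cosh w - 1 ≤ w ^ 2 / 2 * Real.cosh w := by
  have h1 := Real.cosh_le_exp_half_sq w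
  have h2 := Real.add_one_le_exp (-(w ^ 2 / 2))
  have h3 : Real.cosh w * Real.exp (-(w ^ 2 / 2)) ≤ 1 := by
    rw [Real.exp_neg, ← div_eq_mul_inv, div_le_one (Real.exp_pos _)]
    exact h1
  nlinarith [Real.cosh_pos w]

lemma norm_feature_secondDifference_sq (x u v : Param d) :
    ‖feature d h (x + u + v) - feature d h (x + u) - feature d h (x + v) + feature d h x‖ ^ 2
      = 4 * (1 - Real.exp (-‖u‖ ^ 2 / h)) * (1 - Real.exp (-‖v‖ ^ 2 / h))
        + 4 * (Real.exp (-‖u‖ ^ 2 / h) * Real.exp (-‖v‖ ^ 2 / h)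
          * (Real.cosh (2 * inner ℝ u v / h) - 1)) := by
  have hk : ∀ y z : Param d, inner ℝ (feature d h y) (feature d h z)
      = Real.exp (-‖y - z‖ ^ 2 / h) := fun y z => inner_feature_feature y z
  rw [← real_inner_self_eq_norm_sq]
  simp only [inner_add_left, inner_add_right, inner_sub_left, inner_sub_right, hk]
  have e1 : x + u + v - (x + u) = v := by abel
  have e2 : x + u + v - (x + v) = u := by abel
  have e3 : x + u + v - x = u + v := by abel
  have e4 : x + u - (x + u + v) = -v := by abel
  have e5 : x + u - (x + v) = u - v := by abel
  have e6 : x + u - x = u := by abel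
  have e7 : x + v - (x + u + v) = -u := by abel
  have e8 : x + v - (x + u) = -(u - v) := by abel
  have e9 : x + v - x = v := by abel
  have e10 : x - (x + u + v) = -(u + v) := by abel
  have e11 : x - (x + u) = -u := by abel
  have e12 : x - (x + v) = -v := by abel
  simp only [e1, e2, e3, e4, e5, e6, e7, e8, e9, e10, e11, e12, norm_neg, sub_self, norm_zero]
  have f1 : Real.exp (-‖u + v‖ ^ 2 / h) = Real.exp (-‖u‖ ^ 2 / h) * Real.exp (-‖v‖ ^ 2 / h)
      * Real.exp (-(2 * inner ℝ u v / h)) := by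
    rw [← Real.exp_add, ← Real.exp_add, norm_add_sq_real]
    congr 1
    ring
  have f2 : Real.exp (-‖u - v‖ ^ 2 / h) = Real.exp (-‖u‖ ^ 2 / h) * Real.exp (-‖v‖ ^ 2 / h)
      * Real.exp (2 * inner ℝ u v / h) := by
    rw [← Real.exp_add, ← Real.exp_add, norm_sub_sq_real]
    congr 1
    ring
  rw [f1, f2, Real.cosh_eq]
  norm_num
  ring

lemma norm_feature_secondDifference_le (x u v : Param d) :
    ‖feature d h (x + u + v) - feature d h (x + u) - feature d h (x + v) + feature d h x‖
      ≤ 4 / h * ‖u‖ * ‖v‖ := by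
  refine abs_le_of_sq_le_sq' ?_ (by positivity) |>.2
  rw [norm_feature_secondDifference_sq]
  set w : ℝ := 2 * inner ℝ u v / h with hw
  set a : ℝ := ‖u‖ ^ 2 / h with ha
  set b : ℝ := ‖v‖ ^ 2 / h with hb
  have ha0 : 0 ≤ a := by positivity
  have hwabs : |w| ≤ 2 * (‖u‖ * ‖v‖) / h := by
    rw [hw, abs_div, abs_mul, abs_two, abs_of_nonneg (NNReal.coe_nonneg h)]
    gcongr
    exact abs_real_inner_le_norm u v
  have hw2 : w ^ 2 ≤ 4 * (a * b) := by
    calc w ^ 2 = |w| ^ 2 := (sq_abs w).symm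
      _ ≤ (2 * (‖u‖ * ‖v‖) / h) ^ 2 := by gcongr
      _ = 4 * (a * b) := by rw [ha, hb]; ring
  -- Since `|w| ≤ 2 ‖u‖ ‖v‖ / h`, completing the square makes the total exponent at most `-(‖u‖ -
  -- ‖v‖)² / h ≤ 0`.
  have hcosh : Real.exp (-‖u‖ ^ 2 / h) * Real.exp (-‖v‖ ^ 2 / h) * Real.cosh w ≤ 1 := by
    have h1 : Real.cosh w ≤ Real.exp |w| := by
      rw [← Real.cosh_abs, Real.cosh_eq]
      have : Real.exp (-|w|) ≤ Real.exp |w| := Real.exp_le_exp.mpr (by linarith [abs_nonneg w])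
      linarith
    calc _ ≤ Real.exp (-‖u‖ ^ 2 / h) * Real.exp (-‖v‖ ^ 2 / h) * Real.exp |w| := by gcongr
      _ = Real.exp (-‖u‖ ^ 2 / h + -‖v‖ ^ 2 / h + |w|) := by rw [← Real.exp_add, ← Real.exp_add]
      _ ≤ 1 := by
        rw [Real.exp_le_one_iff]
        have h2 : 0 ≤ (‖u‖ - ‖v‖) ^ 2 / h := by positivity
        have h3 : -‖u‖ ^ 2 / h + -‖v‖ ^ 2 / h + 2 * (‖u‖ * ‖v‖) / h
          = -((‖u‖ - ‖v‖) ^ 2 / h) := by ring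
        linarith
  have hterm : Real.exp (-‖u‖ ^ 2 / h) * Real.exp (-‖v‖ ^ 2 / h) * (Real.cosh w - 1)
      ≤ 2 * (a * b) := by
    calc _ ≤ Real.exp (-‖u‖ ^ 2 / h) * Real.exp (-‖v‖ ^ 2 / h) * (w ^ 2 / 2 * Real.cosh w) := by
          gcongr
          exact cosh_sub_one_le w
      _ = w ^ 2 / 2 * (Real.exp (-‖u‖ ^ 2 / h) * Real.exp (-‖v‖ ^ 2 / h) * Real.cosh w) := by ring
      _ ≤ w ^ 2 / 2 * 1 := by gcongr
      _ ≤ 2 * (a * b) := by linarith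
  have hprod : (1 - Real.exp (-‖u‖ ^ 2 / h)) * (1 - Real.exp (-‖v‖ ^ 2 / h)) ≤ a * b :=
    mul_le_mul (one_sub_exp_neg_le u) (one_sub_exp_neg_le v) (one_sub_exp_neg_nonneg v) ha0
  -- The two summands give `4 a b` and `8 a b`; rounding up to `16 a b` makes the bound the square
  -- of `4 ‖u‖ ‖v‖ / h`.
  calc _ ≤ 12 * (a * b) := by linarith
    _ ≤ 16 * (a * b) := by have : 0 ≤ a * b := by positivity
                           linarith
    _ = _ := by rw [ha, hb]; ring

lemma exists_hasFDerivAt_feature (d : ℕ) (h : ℝ≥0) :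
    ∃ D : Param d → Param d →L[ℝ] RBFSpace d h, Continuous D ∧
      ∀ x, HasFDerivAt (feature d h) (D x) x :=
  exists_hasFDerivAt_of_secondDifference_le norm_feature_add_sub_le
    norm_feature_secondDifference_le

lemma differentiable_feature : Differentiable ℝ (feature d h) := fun x =>
  (exists_hasFDerivAt_feature d h).choose_spec.2 x |>.differentiableAt

lemma continuous_fderiv_feature : Continuous (fderiv ℝ (feature d h)) := by
  obtain ⟨D, hD, hf⟩ := exists_hasFDerivAt_feature d h
  rwa [funext fun x => (hf x).fderiv]

lemma continuous_featureGradient : Continuous (featureGradient d h) :=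
  (PiLp.continuous_toLp 2 _).comp
    (continuous_pi fun _ => continuous_fderiv_feature.clm_apply continuous_const)

/-- By translation invariance of the kernel, the derivative of the feature map has constant norm. -/
lemma norm_fderiv_feature_apply_eq (x y u : Param d) :
    ‖fderiv ℝ (feature d h) x u‖ = ‖fderiv ℝ (feature d h) y u‖ := by
  have key : ∀ z : Param d, Filter.Tendsto
      (fun t : ℝ => |t⁻¹| * Real.sqrt (2 - 2 * Real.exp (-‖t • u‖ ^ 2 / h)))
      (nhdsWithin 0 {0}ᶜ) (nhds ‖fderiv ℝ (feature d h) z u‖) := by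
    intro z
    have h1 := ((differentiable_feature (h := h) z).hasFDerivAt.hasLineDerivAt
      u).tendsto_slope_zero.norm
    refine h1.congr fun t => ?_
    rw [norm_smul, Real.norm_eq_abs, ← norm_feature_add_sub_sq z, Real.sqrt_sq (norm_nonneg _)]
  exact tendsto_nhds_unique (key x) (key y)

lemma norm_featureGradient_sq (x : Param d) : ‖featureGradient d h x‖ ^ 2
    = ∑ i, ‖fderiv ℝ (feature d h) x (EuclideanSpace.single i 1)‖ ^ 2 := by
  rw [PiLp.norm_sq_eq_of_L2]
  rfl

lemma norm_featureGradient_eq (x y : Param d) :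
    ‖featureGradient d h x‖ = ‖featureGradient d h y‖ := by
  have : ‖featureGradient d h x‖ ^ 2 = ‖featureGradient d h y‖ ^ 2 := by
    simp only [norm_featureGradient_sq, norm_fderiv_feature_apply_eq x y]
  exact (sq_eq_sq₀ (norm_nonneg _) (norm_nonneg _)).mp this

/-- The kernel bound on a nonempty set holds on the whole space. -/
lemma KernelBound.univ {Θ : Set (Param d)} {B : ℝ} (hB : KernelBound h Θ B) (hΘ : Θ.Nonempty) :
    KernelBound h (Set.univ : Set (Param d)) B := by
  obtain ⟨y, hy⟩ := hΘ
  refine ⟨hB.1, fun x _ => ⟨?_, ?_⟩⟩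
  · rw [norm_feature x, ← norm_feature y]
    exact (hB.2 y hy).1
  · rw [norm_featureGradient_eq x y]
    exact (hB.2 y hy).2

lemma exists_kernelBound (d : ℕ) (h : ℝ≥0) (Θ : Set (Param d)) : ∃ B, KernelBound h Θ B := by
  refine ⟨max 1 ‖featureGradient d h 0‖, by positivity, fun x _ => ⟨?_, ?_⟩⟩
  · rw [norm_feature]
    exact le_max_left _ _
  · rw [norm_featureGradient_eq x 0]
    exact le_max_right _ _

/-- The operator norm is at most the Hilbert-Schmidt norm, by Cauchy-Schwarz in coordinates. -/
lemma norm_fderiv_feature_le (x : Param d) :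
    ‖fderiv ℝ (feature d h) x‖ ≤ ‖featureGradient d h x‖ := by
  refine ContinuousLinearMap.opNorm_le_bound _ (norm_nonneg _) fun u => ?_
  have h1 : fderiv ℝ (feature d h) x u
      = ∑ i, u i • fderiv ℝ (feature d h) x (EuclideanSpace.single i 1) := by
    conv_lhs => rw [← (EuclideanSpace.basisFun (Fin d) ℝ).sum_repr u]
    simp
  refine abs_le_of_sq_le_sq' ?_ (by positivity) |>.2
  rw [mul_pow, norm_featureGradient_sq, EuclideanSpace.real_norm_sq_eq, mul_comm]
  calc ‖fderiv ℝ (feature d h) x u‖ ^ 2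
      ≤ (∑ i, |u i| * ‖fderiv ℝ (feature d h) x (EuclideanSpace.single i 1)‖) ^ 2 := by
        rw [h1]
        gcongr
        refine (norm_sum_le _ _).trans (le_of_eq ?_)
        simp [norm_smul]
    _ ≤ _ := by
      refine (Finset.sum_mul_sq_le_sq_mul_sq _ _ _).trans (le_of_eq ?_)
      simp

lemma norm_feature_sub_le {B : ℝ} (hB : KernelBound h (Set.univ : Set (Param d)) B) (x y : Param d) :
    ‖feature d h x - feature d h y‖ ≤ B * ‖x - y‖ :=
  convex_univ.norm_image_sub_le_of_norm_fderiv_le (fun z _ => differentiable_feature z)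
    (fun z _ => (norm_fderiv_feature_le z).trans (hB.2 z trivial).2) trivial trivial

end Kernel

/-! ### The transport map and its Jacobian -/

section VectorField

variable {d : ℕ} {h : ℝ≥0}

/-- The vector field on `ℝᵈ` given by an element of `ℋᵈ`. -/
noncomputable def vectorField (φ : RBFSpaceVec d h) (x : Param d) : Param d :=
  WithLp.toLp 2 fun i => φ i x

/-- The Jacobian matrix of `vectorField φ`. -/
noncomputable def jacobian (φ : RBFSpaceVec d h) (x : Param d) : Matrix (Fin d) (Fin d) ℝ :=
  Matrix.of fun i j => inner ℝ (fderiv ℝ (feature d h) x (EuclideanSpace.single j 1)) (φ i)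

/-- The transport map `x ↦ x + ζ φ(x)`. -/
noncomputable def transport (ζ : ℝ) (φ : RBFSpaceVec d h) (x : Param d) : Param d :=
  x + ζ • vectorField φ x

lemma vectorField_apply (φ : RBFSpaceVec d h) (x : Param d) (i : Fin d) :
    vectorField φ x i = inner ℝ (feature d h x) (φ i) := (inner_feature_left x (φ i)).symm

lemma norm_vectorField_le {B : ℝ} (hB : KernelBound h (Set.univ : Set (Param d)) B)
    (φ : RBFSpaceVec d h) (x : Param d) : ‖vectorField φ x‖ ≤ B * ‖φ‖ := by
  have hB0 := hB.1
  refine abs_le_of_sq_le_sq' ?_ (by positivity) |>.2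
  rw [EuclideanSpace.real_norm_sq_eq, mul_pow, PiLp.norm_sq_eq_of_L2, Finset.mul_sum]
  refine Finset.sum_le_sum fun i _ => ?_
  rw [vectorField_apply, ← mul_pow, ← sq_abs]
  gcongr
  exact (abs_real_inner_le_norm _ _).trans (by gcongr; exact (hB.2 x trivial).1)

lemma norm_vectorField_sub_le {B : ℝ} (hB : KernelBound h (Set.univ : Set (Param d)) B)
    (φ : RBFSpaceVec d h) (x y : Param d) :
    ‖vectorField φ x - vectorField φ y‖ ≤ B * ‖φ‖ * ‖x - y‖ := by
  have hB0 := hB.1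
  refine abs_le_of_sq_le_sq' ?_ (by positivity) |>.2
  rw [EuclideanSpace.real_norm_sq_eq, mul_right_comm, mul_pow, PiLp.norm_sq_eq_of_L2 _ φ,
    Finset.mul_sum]
  refine Finset.sum_le_sum fun i _ => ?_
  rw [PiLp.sub_apply, vectorField_apply, vectorField_apply, ← inner_sub_left, ← mul_pow, ← sq_abs]
  gcongr
  exact (abs_real_inner_le_norm _ _).trans (by gcongr; exact norm_feature_sub_le hB x y)

/-- Each entry pairs a partial derivative of the feature map with a component of `φ`, so
Cauchy-Schwarz bounds the Frobenius norm by `‖∇k‖ ‖φ‖`, without a factor depending on the dimension.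
-/
lemma sum_jacobian_sq_le {B : ℝ} (hB : KernelBound h (Set.univ : Set (Param d)) B)
    (φ : RBFSpaceVec d h) (x : Param d) :
    ∑ i, ∑ j, jacobian φ x i j ^ 2 ≤ (B * ‖φ‖) ^ 2 := by
  have h1 : ‖featureGradient d h x‖ ^ 2 ≤ B ^ 2 := by
    gcongr
    exact (hB.2 x trivial).2
  rw [mul_pow, PiLp.norm_sq_eq_of_L2, Finset.mul_sum]
  refine Finset.sum_le_sum fun i _ => ?_
  refine le_trans ?_ (mul_le_mul_of_nonneg_right h1 (sq_nonneg _))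
  rw [norm_featureGradient_sq, Finset.sum_mul]
  refine Finset.sum_le_sum fun j _ => ?_
  rw [← mul_pow, ← sq_abs]
  gcongr
  exact abs_real_inner_le_norm (fderiv ℝ (feature d h) x (EuclideanSpace.single j 1)) (φ i)

lemma hasFDerivAt_vectorField (φ : RBFSpaceVec d h) (x : Param d) :
    HasFDerivAt (vectorField φ)
      (LinearMap.toContinuousLinearMap (Matrix.toEuclideanLin (jacobian φ x))) x := by
  rw [← hasFDerivWithinAt_univ, hasFDerivWithinAt_euclidean]
  intro i
  rw [hasFDerivWithinAt_univ]
  have h1 := ((innerSL ℝ (φ i)).hasFDerivAt (x := feature d h x)).comp x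
    (differentiable_feature x).hasFDerivAt
  have h2 : (fun y => vectorField φ y i) = (innerSL ℝ (φ i)) ∘ feature d h := by
    funext y
    rw [vectorField_apply, Function.comp_apply, innerSL_apply_apply, real_inner_comm]
  rw [h2]
  refine h1.congr_fderiv (ContinuousLinearMap.ext fun u => ?_)
  have h3 : fderiv ℝ (feature d h) x u
      = ∑ j, u j • fderiv ℝ (feature d h) x (EuclideanSpace.single j 1) := by
    conv_lhs => rw [← (EuclideanSpace.basisFun (Fin d) ℝ).sum_repr u]
    simp
  simp only [ContinuousLinearMap.comp_apply, innerSL_apply_apply, h3, inner_sum, inner_smul_right]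
  simp [Matrix.toLpLin_apply, Matrix.mulVec, dotProduct, jacobian, real_inner_comm, mul_comm]

lemma hasFDerivAt_transport (ζ : ℝ) (φ : RBFSpaceVec d h) (x : Param d) :
    HasFDerivAt (transport ζ φ)
      (LinearMap.toContinuousLinearMap (Matrix.toEuclideanLin (1 + ζ • jacobian φ x))) x := by
  refine ((hasFDerivAt_id x).add ((hasFDerivAt_vectorField φ x).const_smul ζ)).congr_fderiv
    (ContinuousLinearMap.ext fun u => ?_)
  ext i
  simp [Matrix.toLpLin_apply]

lemma det_toContinuousLinearMap_toEuclideanLin (M : Matrix (Fin d) (Fin d) ℝ) :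
    (LinearMap.toContinuousLinearMap (Matrix.toEuclideanLin M)).det = M.det := by
  rw [ContinuousLinearMap.det, LinearMap.coe_toContinuousLinearMap]
  exact (congrArg LinearMap.det (congrFun (congrArg DFunLike.coe
    (Matrix.toLpLin_eq_toLin 2 2)) M)).trans (LinearMap.det_toLin _ M)

lemma continuous_transport (ζ : ℝ) (φ : RBFSpaceVec d h) : Continuous (transport ζ φ) :=
  continuous_iff_continuousAt.mpr fun x => (hasFDerivAt_transport ζ φ x).continuousAt

/-- The displacement `ζ φ` is a strict contraction, so it cannot cancel the difference of two
distinct points. -/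
lemma injective_transport {B ζ : ℝ} (hB : KernelBound h (Set.univ : Set (Param d)) B)
    {φ : RBFSpaceVec d h} (hζ : 0 ≤ ζ) (hlt : ζ * (B * ‖φ‖) < 1) :
    Function.Injective (transport ζ φ) := by
  intro x y hxy
  have h1 : x - y = ζ • (vectorField φ y - vectorField φ x) := by
    rw [smul_sub, sub_eq_sub_iff_add_eq_add, add_comm _ y]
    exact hxy
  have h2 : ‖x - y‖ ≤ ζ * (B * ‖φ‖) * ‖x - y‖ := by
    calc ‖x - y‖ = ζ * ‖vectorField φ y - vectorField φ x‖ := by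
          rw [h1, norm_smul, Real.norm_of_nonneg hζ]
      _ ≤ ζ * (B * ‖φ‖ * ‖y - x‖) := by gcongr; exact norm_vectorField_sub_le hB φ y x
      _ = _ := by rw [norm_sub_rev]; ring
  rw [← sub_eq_zero, ← norm_eq_zero]
  nlinarith [norm_nonneg (x - y)]

end VectorField

/-! ### The Stein operator and moment bounds -/

section Stein

variable {d : ℕ} {h : ℝ≥0}

/-- The integrand of the SVGD direction for the score field `G`. -/
noncomputable def steinFeature (h : ℝ≥0) (G : Param d → Param d) (θ : Param d) :
    RBFSpaceVec d h :=
  WithLp.toLp 2 (fun i : Fin d => G θ i • feature d h θ) + featureGradient d h θ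

lemma norm_steinFeature_le {B : ℝ} (hB : KernelBound h (Set.univ : Set (Param d)) B)
    (G : Param d → Param d) (θ : Param d) : ‖steinFeature h G θ‖ ≤ ‖G θ‖ + B := by
  refine (norm_add_le _ _).trans (add_le_add (le_of_eq ?_) (hB.2 θ trivial).2)
  refine (sq_eq_sq₀ (norm_nonneg _) (norm_nonneg _)).mp ?_
  rw [PiLp.norm_sq_eq_of_L2, EuclideanSpace.real_norm_sq_eq]
  simp [norm_smul, norm_feature]

/-- By the reproducing property for values and for derivatives, pairing with `φ` turns the
kernel-valued integrand into the Langevin-Stein operator applied to `φ`. -/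
lemma inner_steinFeature (G : Param d → Param d) (φ : RBFSpaceVec d h) (θ : Param d) :
    inner ℝ φ (steinFeature h G θ)
      = inner ℝ (G θ) (vectorField φ θ) + (jacobian φ θ).trace := by
  rw [steinFeature, inner_add_right, PiLp.inner_apply, PiLp.inner_apply, PiLp.inner_apply]
  congr 1
  · refine Finset.sum_congr rfl fun i _ => ?_
    rw [inner_smul_right, vectorField_apply, real_inner_comm]
    simp [mul_comm]
  · simp only [Matrix.trace, Matrix.diag]
    exact Finset.sum_congr rfl fun i _ => real_inner_comm _ _

lemma continuousOn_steinFeature {Θ : Set (Param d)} {G : Param d → Param d}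
    (hG : ContinuousOn G Θ) : ContinuousOn (steinFeature h G) Θ := by
  refine ContinuousOn.add ?_ continuous_featureGradient.continuousOn
  refine (PiLp.continuous_toLp 2 _).comp_continuousOn (continuousOn_pi.mpr fun i => ?_)
  refine ContinuousOn.smul (f := fun θ => G θ i) (g := feature d h) ?_
    differentiable_feature.continuous.continuousOn
  exact (EuclideanSpace.proj (𝕜 := ℝ) i).continuous.comp_continuousOn hG

/-- Linear growth of the score is the reason that a first moment suffices for integrability and for
the KSD bound. -/
lemma norm_le_of_lipschitzOnWith {Θ : Set (Param d)} {G : Param d → Param d} {L : ℝ≥0}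
    (hG : LipschitzOnWith L G Θ) {θ₀ θ : Param d} (h₀ : θ₀ ∈ Θ) (hθ : θ ∈ Θ) :
    ‖G θ‖ ≤ ‖G θ₀‖ + L * ‖θ₀‖ + L * ‖θ‖ := by
  have h1 := hG.dist_le_mul θ hθ θ₀ h₀
  rw [dist_eq_norm, dist_eq_norm] at h1
  calc ‖G θ‖ = ‖G θ₀ + (G θ - G θ₀)‖ := by rw [add_sub_cancel]
    _ ≤ ‖G θ₀‖ + L * ‖θ - θ₀‖ := (norm_add_le _ _).trans (by gcongr)
    _ ≤ ‖G θ₀‖ + L * (‖θ‖ + ‖θ₀‖) := by gcongr; exact norm_sub_le _ _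
    _ = _ := by ring

lemma integrable_norm_of_lintegral_le {μ : Measure (Param d)} {R : ℝ≥0}
    (hR : ∫⁻ θ, ‖θ‖ₑ ∂μ ≤ R) : Integrable (fun θ => ‖θ‖) μ :=
  Integrable.norm (f := fun θ => θ)
    ⟨aestronglyMeasurable_id, lt_of_le_of_lt hR ENNReal.coe_lt_top⟩

lemma aestronglyMeasurable_of_continuousOn {F : Type*} [TopologicalSpace F]
    [TopologicalSpace.PseudoMetrizableSpace F]
    {μ : Measure (Param d)} {Θ : Set (Param d)} (hΘ : IsOpen Θ) (hμ : μ Θᶜ = 0)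
    {f : Param d → F} (hf : ContinuousOn f Θ) : AEStronglyMeasurable f μ := by
  have := hf.aestronglyMeasurable (μ := μ) hΘ.measurableSet
  rwa [Measure.restrict_eq_self_of_ae_mem (mem_ae_iff.mpr hμ)] at this

lemma integrable_norm_comp {μ : Measure (Param d)} [IsFiniteMeasure μ] {Θ : Set (Param d)}
    (hΘ : IsOpen Θ) (hμ : μ Θᶜ = 0) {R L : ℝ≥0} (hR : ∫⁻ θ, ‖θ‖ₑ ∂μ ≤ R)
    {G : Param d → Param d} (hG : LipschitzOnWith L G Θ) {θ₀ : Param d} (h₀ : θ₀ ∈ Θ) :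
    Integrable (fun θ => ‖G θ‖) μ := by
  refine Integrable.mono' (g := fun θ => ‖G θ₀‖ + L * ‖θ₀‖ + L * ‖θ‖)
    ((integrable_const _).add ((integrable_norm_of_lintegral_le hR).const_mul _))
    (aestronglyMeasurable_of_continuousOn hΘ hμ hG.continuousOn.norm) ?_
  filter_upwards [mem_ae_iff.mpr hμ] with θ hθ
  rw [norm_norm]
  exact norm_le_of_lipschitzOnWith hG h₀ hθ

lemma integrable_steinFeature {μ : Measure (Param d)} [IsFiniteMeasure μ] {Θ : Set (Param d)}
    (hΘ : IsOpen Θ) (hμ : μ Θᶜ = 0) {R L : ℝ≥0} (hR : ∫⁻ θ, ‖θ‖ₑ ∂μ ≤ R)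
    {G : Param d → Param d} (hG : LipschitzOnWith L G Θ) {θ₀ : Param d} (h₀ : θ₀ ∈ Θ) :
    Integrable (steinFeature h G) μ := by
  obtain ⟨B, hB⟩ := exists_kernelBound d h Set.univ
  exact Integrable.mono' ((integrable_norm_comp hΘ hμ hR hG h₀).add (integrable_const B))
    (aestronglyMeasurable_of_continuousOn hΘ hμ (continuousOn_steinFeature hG.continuousOn))
    (ae_of_all _ fun θ => norm_steinFeature_le hB G θ)

lemma norm_integral_steinFeature_le {Θ : Set (Param d)} {B : ℝ}
    (hB : KernelBound h (Set.univ : Set (Param d)) B) {R L : ℝ≥0}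
    {G : Param d → Param d} (hG : LipschitzOnWith L G Θ) {θ₀ : Param d} (h₀ : θ₀ ∈ Θ)
    {μ : Measure (Param d)} [IsProbabilityMeasure μ] (hμ : μ Θᶜ = 0)
    (hR : ∫⁻ θ, ‖θ‖ₑ ∂μ ≤ R) :
    ‖∫ θ, steinFeature h G θ ∂μ‖ ≤ ‖G θ₀‖ + L * ‖θ₀‖ + L * R + B := by
  have hint := integrable_norm_of_lintegral_le hR
  have h1 : ∫ θ, ‖θ‖ ∂μ ≤ R := by
    rw [integral_norm_eq_lintegral_enorm (f := fun θ => θ) aestronglyMeasurable_id]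
    exact ENNReal.toReal_le_coe_of_le_coe hR
  refine (norm_integral_le_of_norm_le (g := fun θ => ‖G θ₀‖ + L * ‖θ₀‖ + L * ‖θ‖ + B)
    (by fun_prop) ?_).trans ?_
  · filter_upwards [mem_ae_iff.mpr hμ] with θ hθ
    refine (norm_steinFeature_le hB G θ).trans ?_
    gcongr
    exact norm_le_of_lipschitzOnWith hG h₀ hθ
  · rw [integral_add (by fun_prop) (by fun_prop), integral_add (by fun_prop) (by fun_prop),
      integral_const_mul]
    simp only [integral_const, probReal_univ, one_smul]
    gcongr

/-- The squared norm of the SVGD direction is the mean of the Langevin-Stein operator. -/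
lemma norm_sq_integral_steinFeature {μ : Measure (Param d)} {G : Param d → Param d}
    (hint : Integrable (steinFeature h G) μ) {φ : RBFSpaceVec d h}
    (hφ : φ = ∫ θ, steinFeature h G θ ∂μ) :
    Integrable (fun θ => inner ℝ (G θ) (vectorField φ θ) + (jacobian φ θ).trace) μ ∧
    ∫ θ, (inner ℝ (G θ) (vectorField φ θ) + (jacobian φ θ).trace) ∂μ = ‖φ‖ ^ 2 := by
  simp only [← inner_steinFeature]
  refine ⟨hint.const_inner φ, ?_⟩
  rw [integral_inner hint, ← hφ, real_inner_self_eq_norm_sq]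

end Stein

/-! ### Likelihood ratios under a pushforward -/

section ChangeOfVariables

variable {E : Type*} [NormedAddCommGroup E] [NormedSpace ℝ E] [FiniteDimensional ℝ E]
  [MeasurableSpace E] [BorelSpace E]

lemma map_withDensity_det_mul_comp (κ : Measure E) [κ.IsAddHaarMeasure] {T : E → E}
    {T' : E → E →L[ℝ] E} (hT' : ∀ x, HasFDerivAt T (T' x) x) (hT : Function.Injective T)
    {q : E → ℝ≥0∞} :
    (κ.withDensity fun x => ENNReal.ofReal |(T' x).det| * q (T x)).map T
      = (κ.withDensity q).restrict (Set.range T) := by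
  have hTc : Continuous T := continuous_iff_continuousAt.mpr fun x => (hT' x).continuousAt
  have hTe : MeasurableEmbedding T := hTc.measurableEmbedding hT
  ext A hA
  rw [Measure.map_apply hTc.measurable hA, Measure.restrict_apply hA,
    withDensity_apply _ (hTc.measurable hA), withDensity_apply _ (hA.inter hTe.measurableSet_range),
    ← Set.image_preimage_eq_inter_range,
    lintegral_image_eq_lintegral_abs_det_fderiv_mul κ (hTc.measurable hA)
      (fun x _ => (hT' x).hasFDerivWithinAt) hT.injOn]

/-- The log-likelihood ratio of a pushforward under an injective differentiable map with invertible
derivative. -/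
theorem llr_map_of_hasFDerivAt (κ : Measure E) [κ.IsAddHaarMeasure] {T : E → E}
    {T' : E → E →L[ℝ] E} (hT' : ∀ x, HasFDerivAt T (T' x) x) (hdet : ∀ x, (T' x).det ≠ 0)
    (hT : Function.Injective T) {q : E → ℝ≥0∞} (hq : Measurable q) (hq_top : ∀ x, q x ≠ ∞)
    {μ ν : Measure E} [IsFiniteMeasure μ] (hν : ν = κ.withDensity q) (hμν : μ ≪ ν)
    (hqT : ∀ᵐ x ∂μ, q (T x) ≠ 0) :
    μ.map T ≪ ν ∧ ∀ᵐ x ∂μ, llr (μ.map T) ν (T x) = llr μ ν x + Real.log (q x).toReal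
      - Real.log (q (T x)).toReal - Real.log |(T' x).det| := by
  have hTc : Continuous T := continuous_iff_continuousAt.mpr fun x => (hT' x).continuousAt
  have hTe : MeasurableEmbedding T := hTc.measurableEmbedding hT
  have hdet_meas : Measurable fun x => (T' x).det := by
    have : T' = fderiv ℝ T := funext fun x => ((hT' x).fderiv).symm
    rw [this]
    exact ContinuousLinearMap.continuous_det.measurable.comp (measurable_fderiv ℝ T)
  set f : E → ℝ≥0∞ := fun x => ENNReal.ofReal |(T' x).det| * q (T x) with hf
  have hf_meas : Measurable f :=
    (hdet_meas.abs.ennreal_ofReal).mul (hq.comp hTc.measurable)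
  have hf_top : ∀ x, f x ≠ ∞ := fun x => ENNReal.mul_ne_top ENNReal.ofReal_ne_top (hq_top _)
  have hf_zero : ∀ᵐ x ∂μ, f x ≠ 0 := by
    filter_upwards [hqT] with x hx
    exact mul_ne_zero (by simpa using hdet x) hx
  -- `ρ` is the pullback of `ν` along `T`. The density of `T_# μ` with respect to `ν` at `T x` is
  -- then that of `μ` with respect to `ρ` at `x`, which is compared with `dμ/dν` through the common
  -- reference `κ`.
  set ρ : Measure E := κ.withDensity f with hρ
  have hmap : ρ.map T = ν.restrict (Set.range T) := by
    rw [hρ, hν]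
    exact map_withDensity_det_mul_comp κ hT' hT
  have : SigmaFinite ρ := SigmaFinite.withDensity_of_ne_top (ae_of_all _ hf_top)
  have : SigmaFinite ν := hν ▸ SigmaFinite.withDensity_of_ne_top (ae_of_all _ hq_top)
  have hνκ : ν ≪ κ := hν ▸ withDensity_absolutelyContinuous _ _
  have hμκ : μ ≪ κ := hμν.trans hνκ
  have hμρ : μ ≪ ρ := by
    refine Measure.AbsolutelyContinuous.mk fun A _ hA => ?_
    rw [hρ, withDensity_apply_eq_zero hf_meas] at hA
    have h1 : μ {x | f x ≠ 0}ᶜ = 0 := hf_zero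
    refine measure_mono_null (t := ({x | f x ≠ 0} ∩ A) ∪ {x | f x ≠ 0}ᶜ) (fun x hx => ?_)
      (measure_union_null (hμκ hA) h1)
    by_cases h : f x ≠ 0
    · exact Or.inl ⟨h, hx⟩
    · exact Or.inr h
  have hTμ : μ.map T ≪ ν.restrict (Set.range T) := hmap ▸ hμρ.map hTc.measurable
  have hTμν : μ.map T ≪ ν := hTμ.trans Measure.restrict_le_self.absolutelyContinuous
  refine ⟨hTμν, ?_⟩
  have e1 := hμκ.ae_le (Measure.rnDeriv_mul_rnDeriv (κ := κ) hμν)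
  have e2 := hμκ.ae_le (Measure.rnDeriv_mul_rnDeriv (κ := κ) hμρ)
  have e3 := hμκ.ae_le (Measure.rnDeriv_withDensity κ hq)
  have e4 := hμκ.ae_le (Measure.rnDeriv_withDensity κ hf_meas)
  have e5 := hμρ.ae_le (hTe.rnDeriv_map μ ρ)
  have e6 := ae_of_ae_map hTc.measurable.aemeasurable
    (hTμν.ae_le (Measure.rnDeriv_mul_rnDeriv (κ := ν) hTμ))
  have e7 := ae_of_ae_map hTc.measurable.aemeasurable
    (hTμν.ae_le (Measure.rnDeriv_restrict_self ν hTe.measurableSet_range))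
  filter_upwards [e1, e2, e3, e4, e5, e6, e7, hf_zero, hqT, Measure.rnDeriv_pos hμν,
    hμν.ae_le (Measure.rnDeriv_ne_top μ ν), Measure.rnDeriv_pos hμρ,
    hμρ.ae_le (Measure.rnDeriv_ne_top μ ρ)] with x h1 h2 h3 h4 h5 h6 h7 h8 h9 hb hbt ha hat
  rw [Pi.mul_apply] at h1 h2 h6
  rw [h7, Set.indicator_of_mem (Set.mem_range_self x), Pi.one_apply, mul_one, ← hmap, h5] at h6
  rw [← hν] at h3
  rw [h3] at h1
  rw [h4] at h2
  -- Both products are the density of `μ` with respect to `κ` at `x`.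
  have key := congrArg ENNReal.toReal (h1.trans h2.symm)
  rw [ENNReal.toReal_mul, ENNReal.toReal_mul] at key
  have hb' : (μ.rnDeriv ν x).toReal ≠ 0 := ENNReal.toReal_ne_zero.mpr ⟨hb.ne', hbt⟩
  have ha' : (μ.rnDeriv ρ x).toReal ≠ 0 := ENNReal.toReal_ne_zero.mpr ⟨ha.ne', hat⟩
  have hf' : (f x).toReal ≠ 0 := ENNReal.toReal_ne_zero.mpr ⟨h8, hf_top x⟩
  have hqx : (q x).toReal ≠ 0 := fun h => mul_ne_zero ha' hf' (by rw [← key, h, mul_zero])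
  have hqT' : (q (T x)).toReal ≠ 0 := ENNReal.toReal_ne_zero.mpr ⟨h9, hq_top _⟩
  have hdx : |(T' x).det| ≠ 0 := abs_ne_zero.mpr (hdet x)
  have hfx : (f x).toReal = |(T' x).det| * (q (T x)).toReal := by
    rw [hf, ENNReal.toReal_mul, ENNReal.toReal_ofReal (abs_nonneg _)]
  have hlog := congrArg Real.log key
  rw [Real.log_mul hb' hqx, Real.log_mul ha' hf', hfx, Real.log_mul hdx hqT'] at hlog
  rw [llr, llr, ← h6]
  linarith

end ChangeOfVariables

/-! ### The posterior and one step of descent -/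

section Descent

variable {d : ℕ} {h : ℝ≥0} {Θ : Set (Param d)} {p δL : Param d → ℝ}

lemma isProbabilityMeasure_densityMeasure (hΘ : MeasurableSet Θ) {q : Param d → ℝ}
    (hq : ∀ θ ∈ Θ, 0 ≤ q θ) (hq_one : ∫ θ in Θ, q θ = 1) :
    IsProbabilityMeasure (densityMeasure Θ q) := by
  refine ⟨?_⟩
  rw [densityMeasure, withDensity_apply _ MeasurableSet.univ, Measure.restrict_univ,
    ← ofReal_integral_eq_lintegral_ofReal, hq_one, ENNReal.ofReal_one]
  · exact not_imp_comm.mp integral_undef (by rw [hq_one]; exact one_ne_zero)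
  · exact (ae_restrict_iff' hΘ).mpr (ae_of_all _ hq)

lemma normalizer_pos (hΘ_open : IsOpen Θ) (hΘ : Θ.Nonempty)
    (hV_int : IntegrableOn (fun θ => Real.exp (-potential δL p θ)) Θ) :
    0 < ∫ θ in Θ, Real.exp (-potential δL p θ) := by
  have : NeZero ((volume : Measure (Param d)).restrict Θ) :=
    ⟨by rw [Ne, Measure.restrict_eq_zero]; exact (hΘ_open.measure_pos _ hΘ).ne'⟩
  exact integral_exp_pos hV_int

lemma posterior_pos (hΘ_open : IsOpen Θ) (hΘ : Θ.Nonempty)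
    (hV_int : IntegrableOn (fun θ => Real.exp (-potential δL p θ)) Θ) (θ : Param d) :
    0 < posterior Θ δL p θ := div_pos (Real.exp_pos _) (normalizer_pos hΘ_open hΘ hV_int)

lemma integral_posterior (hΘ_open : IsOpen Θ) (hΘ : Θ.Nonempty)
    (hV_int : IntegrableOn (fun θ => Real.exp (-potential δL p θ)) Θ) :
    ∫ θ in Θ, posterior Θ δL p θ = 1 := by
  simp only [posterior]
  rw [integral_div, div_self (normalizer_pos hΘ_open hΘ hV_int).ne']

lemma log_posterior (hΘ_open : IsOpen Θ) (hΘ : Θ.Nonempty)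
    (hV_int : IntegrableOn (fun θ => Real.exp (-potential δL p θ)) Θ) (θ : Param d) :
    Real.log (posterior Θ δL p θ)
      = -potential δL p θ - Real.log (∫ θ in Θ, Real.exp (-potential δL p θ)) := by
  rw [posterior, Real.log_div (Real.exp_pos _).ne' (normalizer_pos hΘ_open hΘ hV_int).ne',
    Real.log_exp]

lemma gradient_log_posterior (hΘ_open : IsOpen Θ) (hΘ : Θ.Nonempty)
    (hV_int : IntegrableOn (fun θ => Real.exp (-potential δL p θ)) Θ) (θ : Param d) :
    gradient (fun ν => Real.log (posterior Θ δL p ν)) θ = -gradient (potential δL p) θ := by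
  simp only [log_posterior hΘ_open hΘ hV_int]
  rw [gradient, fderiv_sub_const, fderiv_fun_neg, map_neg, gradient]

lemma steinDirection_posterior (hΘ_open : IsOpen Θ) (hΘ : Θ.Nonempty)
    (hV_int : IntegrableOn (fun θ => Real.exp (-potential δL p θ)) Θ) (μ : Measure (Param d)) :
    steinDirection h (posterior Θ δL p) μ
      = ∫ θ, steinFeature h (fun θ => -gradient (potential δL p) θ) θ ∂μ := by
  simp only [steinDirection, gradient_log_posterior hΘ_open hΘ hV_int, steinFeature]

lemma lipschitzOnWith_neg {G : Param d → Param d} {L : ℝ≥0} (hG : LipschitzOnWith L G Θ) :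
    LipschitzOnWith L (fun θ => -G θ) Θ := fun x hx y hy => by
  rw [edist_neg_neg]
  exact hG hx hy

lemma exists_ksdBound (hΘ_open : IsOpen Θ) (hΘ : Θ.Nonempty) {L : ℝ≥0}
    (hV_lip : LipschitzOnWith L (gradient (potential δL p)) Θ)
    (hV_int : IntegrableOn (fun θ => Real.exp (-potential δL p θ)) Θ) (R : ℝ≥0) :
    ∃ C, KSDBound h (posterior Θ δL p) Θ R C := by
  obtain ⟨B, hB⟩ := exists_kernelBound d h Set.univ
  have hB0 := hB.1
  obtain ⟨θ₀, h₀⟩ := hΘ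
  refine ⟨(‖-gradient (potential δL p) θ₀‖ + L * ‖θ₀‖ + L * R + B) ^ 2, by positivity,
    fun ν _ hν hR => ?_⟩
  rw [ksd, steinDirection_posterior hΘ_open ⟨θ₀, h₀⟩ hV_int]
  gcongr
  exact norm_integral_steinFeature_le hB (lipschitzOnWith_neg hV_lip) h₀ hν hR

/-- One step of SVGD decreases the Kullback-Leibler divergence to the posterior. -/
theorem klDiv_map_transport_add_le (hΘ_open : IsOpen Θ) (hΘ_convex : Convex ℝ Θ)
    (hΘ : Θ.Nonempty) {L : ℝ≥0}
    (hV_diff : DifferentiableOn ℝ (potential δL p) Θ)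
    (hV_lip : LipschitzOnWith L (gradient (potential δL p)) Θ)
    (hV_int : IntegrableOn (fun θ => Real.exp (-potential δL p θ)) Θ)
    {B α ζ : ℝ} (hB : KernelBound h (Set.univ : Set (Param d)) B) (hα : 1 < α) (hζ : 0 < ζ)
    {μ : Measure (Param d)} [IsProbabilityMeasure μ] (hμ : μ Θᶜ = 0) {R : ℝ≥0}
    (hR : ∫⁻ θ, ‖θ‖ₑ ∂μ ≤ R) {φ : RBFSpaceVec d h}
    (hφ : φ = steinDirection h (posterior Θ δL p) μ)
    (hζφ : ζ * (B * ‖φ‖) ≤ (α - 1) / α) (hc : 0 ≤ stepConst α B L ζ)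
    (hTμ : (μ.map (transport ζ φ)) Θᶜ = 0) :
    InformationTheory.klDiv (μ.map (transport ζ φ)) (densityMeasure Θ (posterior Θ δL p))
        + ENNReal.ofReal (stepConst α B L ζ * ‖φ‖ ^ 2)
      ≤ InformationTheory.klDiv μ (densityMeasure Θ (posterior Θ δL p)) := by
  set V := potential δL p with hV
  set T := transport ζ φ with hT
  set ν := densityMeasure Θ (posterior Θ δL p) with hν
  have hB0 := hB.1
  by_cases htop : InformationTheory.klDiv μ ν = ∞
  · rw [htop]
    exact le_top
  obtain ⟨hμν, hllr⟩ := InformationTheory.klDiv_ne_top_iff.mp htop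
  have hq_pos := posterior_pos (p := p) (δL := δL) hΘ_open hΘ hV_int
  have : IsProbabilityMeasure ν := isProbabilityMeasure_densityMeasure hΘ_open.measurableSet
    (fun θ _ => (hq_pos θ).le) (integral_posterior hΘ_open hΘ hV_int)
  have hTm : Measurable T := (continuous_transport ζ φ).measurable
  have : IsProbabilityMeasure (μ.map T) := Measure.isProbabilityMeasure_map hTm.aemeasurable
  have hlt : (α - 1) / α < 1 := by rw [div_lt_one (by linarith)]; linarith
  have hTinj : Function.Injective T := injective_transport hB hζ.le (hζφ.trans_lt hlt)
  have hdet : ∀ x, (1 + ζ • jacobian φ x).det ≠ 0 ∧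
      |Real.log (1 + ζ • jacobian φ x).det - ζ * (jacobian φ x).trace|
        ≤ α * (B * ‖φ‖) ^ 2 * ζ ^ 2 / 2 := fun x =>
    abs_log_det_sub_trace_le hα hζ.le (sum_jacobian_sq_le hB φ x) (by positivity) hζφ
  -- The indicator is needed because the posterior density is known to be continuous only on `Θ`.
  have hq_meas : Measurable (Θ.indicator fun θ => ENNReal.ofReal (posterior Θ δL p θ)) := by
    classical
    rw [← Set.piecewise_eq_indicator]
    refine ContinuousOn.measurable_piecewise ?_ continuousOn_const hΘ_open.measurableSet
    refine ENNReal.continuous_ofReal.comp_continuousOn ?_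
    exact (Real.continuous_exp.comp_continuousOn hV_diff.continuousOn.neg).div_const _
  have hmem : ∀ᵐ x ∂μ, x ∈ Θ := mem_ae_iff.mpr hμ
  have hTmem : ∀ᵐ x ∂μ, T x ∈ Θ := ae_of_ae_map hTm.aemeasurable (mem_ae_iff.mpr hTμ)
  obtain ⟨hTμν, hratio⟩ := llr_map_of_hasFDerivAt volume (hasFDerivAt_transport ζ φ)
    (fun x => by rw [det_toContinuousLinearMap_toEuclideanLin]; exact (hdet x).1) hTinj hq_meas
    (fun x => ((Set.indicator_le_self Θ _ x).trans_lt ENNReal.ofReal_lt_top).ne)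
    (by rw [hν, densityMeasure, withDensity_indicator hΘ_open.measurableSet]) hμν
    (by
      filter_upwards [hTmem] with x hx
      rw [Set.indicator_of_mem hx]
      simpa using hq_pos (T x))
  rw [← hT] at hratio hTμν
  set G : Param d → Param d := fun θ => -gradient V θ with hG
  have hG_lip : LipschitzOnWith L G Θ := lipschitzOnWith_neg hV_lip
  obtain ⟨θ₀, h₀⟩ := hΘ
  obtain ⟨hs_int, hs⟩ := norm_sq_integral_steinFeature (φ := φ)
    (integrable_steinFeature hΘ_open hμ hR hG_lip h₀)
    (hφ.trans (steinDirection_posterior hΘ_open ⟨θ₀, h₀⟩ hV_int μ))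
  set s : Param d → ℝ := fun θ => inner ℝ (G θ) (vectorField φ θ) + (jacobian φ θ).trace
  set K : ℝ := ζ ^ 2 * (α ^ 2 + L) * (B * ‖φ‖) ^ 2 / 2 with hK
  set r : Param d → ℝ := fun x => llr (μ.map T) ν (T x) - llr μ ν x with hr
  -- The bound is two-sided because it also yields integrability of `r`, hence finiteness of the
  -- divergence after the step.
  have hr_bound : ∀ᵐ x ∂μ, |r x + ζ * s x| ≤ K := by
    filter_upwards [hratio, hmem, hTmem] with x hx hxΘ hTx
    rw [Set.indicator_of_mem hxΘ, Set.indicator_of_mem hTx,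
      ENNReal.toReal_ofReal (hq_pos _).le, ENNReal.toReal_ofReal (hq_pos _).le,
      log_posterior hΘ_open ⟨θ₀, h₀⟩ hV_int, log_posterior hΘ_open ⟨θ₀, h₀⟩ hV_int,
      det_toContinuousLinearMap_toEuclideanLin, Real.log_abs] at hx
    have h1 := abs_sub_sub_inner_gradient_le hΘ_open hΘ_convex hV_diff hV_lip hxΘ hTx
    have h2 : T x - x = ζ • vectorField φ x := by rw [hT, transport, add_sub_cancel_left]
    rw [h2, inner_smul_right, norm_smul, Real.norm_of_nonneg hζ.le] at h1
    have h3 : L / 2 * (ζ * ‖vectorField φ x‖) ^ 2 ≤ L / 2 * (ζ * (B * ‖φ‖)) ^ 2 := by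
      gcongr
      exact norm_vectorField_le hB φ x
    -- The log-determinant estimate gives `α`; it is weakened to `α²`, the constant in `c_ζ`.
    have h4 : α * (B * ‖φ‖) ^ 2 * ζ ^ 2 / 2 ≤ α ^ 2 * (B * ‖φ‖) ^ 2 * ζ ^ 2 / 2 := by
      gcongr
      nlinarith
    have h5 : r x + ζ * s x = (V (T x) - V x - ζ * inner ℝ (gradient V x) (vectorField φ x))
        - (Real.log (1 + ζ • jacobian φ x).det - ζ * (jacobian φ x).trace) := by
      simp only [hr, s, hG, hx, inner_neg_left]
      ring
    rw [h5]
    refine (abs_sub _ _).trans ((add_le_add (h1.trans h3) ((hdet x).2.trans h4)).trans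
      (le_of_eq ?_))
    rw [hK]
    ring
  have hr_meas : AEStronglyMeasurable r μ :=
    (((measurable_llr _ _).comp hTm).sub (measurable_llr _ _)).aestronglyMeasurable
  have hrs_int : Integrable (fun x => r x + ζ * s x) μ :=
    Integrable.of_bound (hr_meas.add (hs_int.const_mul ζ).aestronglyMeasurable) K hr_bound
  have hr_int : Integrable r μ := by
    refine (hrs_int.sub (hs_int.const_mul ζ)).congr (ae_of_all _ fun x => ?_)
    simp
  have hr_le : ∫ x, r x ∂μ ≤ -(stepConst α B L ζ * ‖φ‖ ^ 2) := by
    have h1 : ∫ x, (r x + ζ * s x) ∂μ ≤ K := by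
      refine (integral_mono_ae hrs_int (integrable_const K)
        (hr_bound.mono fun x hx => (abs_le.mp hx).2)).trans (le_of_eq ?_)
      simp
    -- The mean of `s` is `‖φ‖²`, and `ζ ‖φ‖² - K = c_ζ ‖φ‖²`.
    rw [integral_add hr_int (hs_int.const_mul ζ), integral_const_mul, hs] at h1
    rw [hK] at h1
    rw [stepConst]
    linarith
  have hllr_comp : Integrable (fun x => llr (μ.map T) ν (T x)) μ := by
    refine (hr_int.add hllr).congr (ae_of_all _ fun x => ?_)
    simp [hr]
  have hllr' : Integrable (llr (μ.map T) ν) (μ.map T) :=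
    (integrable_map_measure (measurable_llr _ _).aestronglyMeasurable hTm.aemeasurable).mpr
      hllr_comp
  have hsum : ∫ y, llr (μ.map T) ν y ∂(μ.map T) = ∫ x, llr μ ν x ∂μ + ∫ x, r x ∂μ := by
    rw [integral_map hTm.aemeasurable (measurable_llr _ _).aestronglyMeasurable,
      ← integral_add hllr hr_int]
    refine integral_congr_ae (ae_of_all _ fun x => ?_)
    simp [hr]
  have hnonneg := InformationTheory.integral_llr_add_sub_measure_univ_nonneg hTμν hllr'
  rw [InformationTheory.klDiv_of_ac_of_integrable hTμν hllr',
    InformationTheory.klDiv_of_ac_of_integrable hμν hllr,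
    ← ENNReal.ofReal_add hnonneg (by positivity)]
  refine ENNReal.ofReal_le_ofReal ?_
  simp only [probReal_univ]
  linarith

lemma isProbabilityMeasure_svgdIterate (q : Param d → ℝ) (ζ : ℝ) (μ₀ : Measure (Param d))
    [IsProbabilityMeasure μ₀] (t : ℕ) : IsProbabilityMeasure (svgdIterate h q ζ μ₀ t) := by
  induction t with
  | zero => assumption
  | succ t ih =>
    exact Measure.isProbabilityMeasure_map (continuous_transport ζ _).measurable.aemeasurable

end Descent

end SVGD

/-! ### Summation over the iterates -/

theorem mainTheorem1 (d : ℕ) (h : ℝ≥0) (hh : 0 < h)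
    (Θ : Set (SVGD.Param d)) (hΘ_open : IsOpen Θ) (hΘ_convex : Convex ℝ Θ)
    (p δL : SVGD.Param d → ℝ)
    (hp_smooth : ContDiffOn ℝ (⊤ : ℕ∞) p Θ) (hp_pos : ∀ θ ∈ Θ, 0 < p θ)
    (hp_prob : ∫ θ in Θ, p θ = 1)
    (L : ℝ≥0)
    (hV_diff : DifferentiableOn ℝ (SVGD.potential δL p) Θ)
    (hV_lip : LipschitzOnWith L (gradient (SVGD.potential δL p)) Θ)
    (hV_int : IntegrableOn (fun θ => Real.exp (-SVGD.potential δL p θ)) Θ)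
    (R : ℝ≥0) (p' : SVGD.Param d → ℝ) (hp' : p' = SVGD.posterior Θ δL p)
    (μ : ℝ → ℕ → Measure (SVGD.Param d))
    (hμ : ∀ ζ, μ ζ = SVGD.svgdIterate h p' ζ (SVGD.densityMeasure Θ p)) :
    (∃ B, SVGD.KernelBound h Θ B) ∧ (∃ C, SVGD.KSDBound h p' Θ R C) ∧
    ∀ B C α : ℝ, SVGD.KernelBound h Θ B → SVGD.KSDBound h p' Θ R C → 1 < α →
      ∀ ζ : ℝ, 0 < ζ → ζ ≤ (α - 1) / (α * B * Real.sqrt C) → ζ < 2 / ((α ^ 2 + L) * B ^ 2) →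
        0 < SVGD.stepConst α B L ζ ∧
        ∀ N : ℕ, 1 ≤ N →
          (∀ t ≤ N + 1, μ ζ t Θᶜ = 0) →
          (Θ ⊆ Metric.closedBall 0 R ∨ ∀ t ≤ N + 1, ∫⁻ θ, ‖θ‖ₑ ∂(μ ζ t) ≤ R) →
          ENNReal.ofReal ((1 / N : ℝ) * ∑ i ∈ Finset.Icc 1 N, SVGD.ksd h p' (μ ζ i)) ≤
            InformationTheory.klDiv (SVGD.densityMeasure Θ p) (SVGD.densityMeasure Θ p') /
              ENNReal.ofReal (N * SVGD.stepConst α B L ζ) := by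
  have hΘ : Θ.Nonempty := by
    rw [Set.nonempty_iff_ne_empty]
    rintro rfl
    simp at hp_prob
  subst hp'
  refine ⟨SVGD.exists_kernelBound d h Θ, SVGD.exists_ksdBound hΘ_open hΘ hV_lip hV_int R, ?_⟩
  intro B C α hB hC hα ζ hζ hζ1 hζ2
  have hB0 := hB.1
  have hα0 : 0 < α := by linarith
  have hC0 : 0 < Real.sqrt C := Real.sqrt_pos.mpr hC.1
  have hc : 0 < SVGD.stepConst α B L ζ := by
    have h1 : 0 < (α ^ 2 + L) * B ^ 2 := by positivity
    rw [lt_div_iff₀ h1] at hζ2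
    exact mul_pos hζ (by linarith)
  have hζC : ζ * (B * Real.sqrt C) ≤ (α - 1) / α := by
    rw [le_div_iff₀ (by positivity)] at hζ1
    rw [le_div_iff₀ hα0]
    linarith
  refine ⟨hc, fun N hN hconc hmom => ?_⟩
  have hμ₀ : IsProbabilityMeasure (SVGD.densityMeasure Θ p) :=
    SVGD.isProbabilityMeasure_densityMeasure hΘ_open.measurableSet
      (fun θ hθ => (hp_pos θ hθ).le) hp_prob
  have hprob : ∀ t, IsProbabilityMeasure (μ ζ t) := fun t => by
    rw [hμ ζ]
    exact SVGD.isProbabilityMeasure_svgdIterate _ ζ _ t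
  have hmoment : ∀ t ≤ N + 1, ∫⁻ θ, ‖θ‖ₑ ∂(μ ζ t) ≤ R := by
    rcases hmom with hsub | hmom
    · intro t ht
      calc ∫⁻ θ, ‖θ‖ₑ ∂(μ ζ t) ≤ ∫⁻ _, (R : ℝ≥0∞) ∂(μ ζ t) := by
            refine lintegral_mono_ae ?_
            filter_upwards [mem_ae_iff.mpr (hconc t ht)] with θ hθ
            have := hsub hθ
            rw [mem_closedBall_zero_iff] at this
            rw [enorm_eq_nnnorm]
            exact_mod_cast this
        _ = R := by simp
    · exact hmom
  set ν := SVGD.densityMeasure Θ (SVGD.posterior Θ δL p)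
  -- The decrease is stated as a sum in `ℝ≥0∞`, without subtraction, so that infinite divergences
  -- are allowed.
  have hstep : ∀ t < N + 1, InformationTheory.klDiv (μ ζ (t + 1)) ν
      + ENNReal.ofReal (SVGD.stepConst α B L ζ * SVGD.ksd h (SVGD.posterior Θ δL p) (μ ζ t))
        ≤ InformationTheory.klDiv (μ ζ t) ν := by
    intro t ht
    have := hprob t
    have hsucc : μ ζ (t + 1) = (μ ζ t).map (SVGD.transport ζ
        (SVGD.steinDirection h (SVGD.posterior Θ δL p) (μ ζ t))) := by
      rw [hμ ζ]
      rfl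
    -- This is where `C` enters: with the first condition on `ζ` it gives `ζ B ‖φ‖ ≤ (α - 1) / α` at
    -- every iterate.
    have hnorm : ‖SVGD.steinDirection h (SVGD.posterior Θ δL p) (μ ζ t)‖ ≤ Real.sqrt C :=
      Real.le_sqrt_of_sq_le (hC.2 (μ ζ t) this (hconc t ht.le) (hmoment t ht.le))
    have hconc' := hconc (t + 1) ht
    rw [hsucc] at hconc' ⊢
    exact SVGD.klDiv_map_transport_add_le hΘ_open hΘ_convex hΘ hV_diff hV_lip hV_int
      (hB.univ hΘ) hα hζ (hconc t ht.le) (hmoment t ht.le) rfl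
      (le_trans (by gcongr) hζC) hc.le hconc'
  have htel : ∀ n ≤ N + 1, InformationTheory.klDiv (μ ζ n) ν
      + ∑ t ∈ Finset.range n, ENNReal.ofReal
        (SVGD.stepConst α B L ζ * SVGD.ksd h (SVGD.posterior Θ δL p) (μ ζ t))
        ≤ InformationTheory.klDiv (SVGD.densityMeasure Θ p) ν := by
    intro n
    induction n with
    | zero =>
      intro _
      rw [Finset.sum_range_zero, add_zero, hμ ζ]
      rfl
    | succ n ih =>
      intro hn
      refine le_trans ?_ (ih (by lia))
      rw [Finset.sum_range_succ, add_comm (∑ t ∈ Finset.range n, _), ← add_assoc]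
      gcongr
      exact hstep n hn
  have hksd : ∀ t, 0 ≤ SVGD.ksd h (SVGD.posterior Θ δL p) (μ ζ t) := fun t => sq_nonneg _
  have hN0 : (0 : ℝ) < N := by exact_mod_cast hN
  rw [ENNReal.le_div_iff_mul_le
    (Or.inl (ENNReal.ofReal_pos.mpr (by positivity)).ne') (Or.inl ENNReal.ofReal_ne_top),
    ← ENNReal.ofReal_mul (mul_nonneg (by positivity) (Finset.sum_nonneg fun t _ => hksd t))]
  calc ENNReal.ofReal (((1 / N : ℝ)
          * ∑ i ∈ Finset.Icc 1 N, SVGD.ksd h (SVGD.posterior Θ δL p) (μ ζ i))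
          * (N * SVGD.stepConst α B L ζ))
      = ∑ t ∈ Finset.Icc 1 N, ENNReal.ofReal
          (SVGD.stepConst α B L ζ * SVGD.ksd h (SVGD.posterior Θ δL p) (μ ζ t)) := by
        rw [← ENNReal.ofReal_sum_of_nonneg fun t _ => mul_nonneg hc.le (hksd t),
          ← Finset.mul_sum]
        congr 1
        field_simp
    -- The telescoped sum runs over `0, …, N`; its nonnegative term at `t = 0` is added here, and
    -- the divergence of `μ_{N+1}` is dropped in the next step.
    _ ≤ ∑ t ∈ Finset.range (N + 1), ENNReal.ofReal
          (SVGD.stepConst α B L ζ * SVGD.ksd h (SVGD.posterior Θ δL p) (μ ζ t)) := by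
        refine Finset.sum_le_sum_of_subset fun t ht => ?_
        rw [Finset.mem_Icc] at ht
        rw [Finset.mem_range]
        lia
    _ ≤ InformationTheory.klDiv (SVGD.densityMeasure Θ p) ν :=
        le_add_self.trans (htel (N + 1) le_rfl)
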